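/- **Theorem 2.1.** Let $d\ge 1$, let $\omega\colon\mathbb R^d\to[0,\infty)$ be continuous, bounded and non-constant, with $\omega_0:=\inf\omega$ and $\omega_1:=\sup\omega$, and let $\lambda\in L^2(\mathbb R^d)$, $\lambda\ne 0$ in $L^2(\mathbb R^d)$. Let $L^2_s(\mathbb R^d\times\mathbb R^d)$ be the space of symmetric functions in $L^2(\mathbb R^d\times\mathbb R^d)$ with $\tfrac12$ times the usual inner product. For $\gamma\in\mathbb R$ and $\alpha>0$ let $$\mathcal A=\begin{pmatrix}A&B\\ C&D\end{pmatrix}\quad\text{on}\quad L^2(\mathbb R^d)\oplus L^2_s(\mathbb R^d\times\mathbb R^d)$$ be the bounded operator matrix with entries $$(Af)(k)=(-\gamma+\omega(k))f(k),\qquad (Bg)(k)=\alpha\int g(k,q)\lambda(q)\,dq,$$ $$(Cf)(k,q)=\alpha\overline{\lambda(k)}f(q)+\alpha\overline{\lambda(q)}f(k),\qquad (Dg)(k,q)=(\gamma+\omega(k)+\omega(q))g(k,q).$$ Let $\sigma_{\rm ess}(\mathcal A)$ be the set of $z\in\mathbb C$ such that $\mathcal A-z$ is not Fredholm. Put $$\Phi(z)=-\gamma-z-\alpha^2\int\frac{|\lambda(q)|^2\,dq}{\omega(q)+\gamma-z},\qquad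 z\in(-\infty,\omega_0+\gamma)\cup(\omega_1+\gamma,\infty).$$ When they exist, $E$ denotes the unique zero of $\Phi$ in $(-\infty,\omega_0+\gamma)$ and $F$ the unique zero of $\Phi$ in $(\omega_1+\gamma,\infty)$. With norms in $L^2(\mathbb R^d)$, define $$\alpha_1=\frac{\sqrt{-2\gamma-\omega_0}}{\bigl\|\lambda/\sqrt{\omega-\omega_0}\bigr\|},\quad \alpha_2=\frac{\sqrt{\omega_1-2\omega_0-2\gamma}}{\bigl\|\lambda/\sqrt{\omega_1-2\omega_0+\omega}\bigr\|},\quad \alpha_3=\frac{\sqrt{\omega_1+2\gamma}}{\bigl\|\lambda/\sqrt{\omega_1-\omega}\bigr\|},\quad \alpha_4=\frac{\sqrt{2\omega_1-\omega_0+2\gamma}}{\bigl\|\lambda/\sqrt{2\omega_1-\omega_0-\omega}\bigr\|}$$ for $\gamma\le-\frac{\omega_0}2$, $\gamma\le\frac{\omega_1}2-\omega_0$, $\gamma\ge-\frac{\omega_1}2$ and $\gamma\ge\frac{\omega_0}2-\omega_1$, respectively; $\alpha_1$ is used only if $\lambda/\sqrt{\omega-\omega_0}\in L^2(\mathbb R^d)$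 and $\alpha_3$ only if $\lambda/\sqrt{\omega_1-\omega}\in L^2(\mathbb R^d)$. (Here $\lambda/\sqrt{w}\in L^2$ means $\int|\lambda|^2/w<\infty$, with $0/0=0$ and $c/0=\infty$ for $c>0$.) Consider the following conditions (one of the first three and one of the last three always holds): * (L0) $\lambda/\sqrt{\omega-\omega_0}\in L^2(\mathbb R^d)$, $\gamma\le-\frac{\omega_0}2$ and $\alpha\le\alpha_1$; * (L1) (L0) fails, $\gamma\le\frac{\omega_1}2-\omega_0$ and $\alpha\le\alpha_2$; * (L2) $\gamma>\frac{\omega_1}2-\omega_0$, or $\gamma\le\frac{\omega_1}2-\omega_0$ and $\alpha>\alpha_2$; and * (U0) $\lambda/\sqrt{\omega_1-\omega}\in L^2(\mathbb R^d)$, $\gamma\ge-\frac{\omega_1}2$ and $\alpha\le\alpha_3$; * (U1) (U0) fails, $\gamma\ge\frac{\omega_0}2-\omega_1$ and $\alpha\le\alpha_4$; * (U2) $\gamma<\frac{\omega_0}2-\omega_1$, or $\gamma\ge\frac{\omega_0}2-\omega_1$ and $\alpha>\alpha_4$. The zero $E$ exists and is unique in the cases (L1) and (L2), the zero $F$ exists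 and is unique in the cases (U1) and (U2), and $\sigma_{\rm ess}(\mathcal A)$ is the following subset of $\mathbb R$: | | (U0) | (U1) | (U2) | |---|---|---|---| | (L0) | $[2\omega_0+\gamma,2\omega_1+\gamma]$ | $[2\omega_0+\gamma,\omega_1+F]$ | $[2\omega_0+\gamma,2\omega_1+\gamma]\cup[\omega_0+F,\omega_1+F]$ | | (L1) | $[\omega_0+E,2\omega_1+\gamma]$ | $[\omega_0+E,\omega_1+F]$ | $[\omega_0+E,2\omega_1+\gamma]\cup[\omega_0+F,\omega_1+F]$ | | (L2) | $[\omega_0+E,\omega_1+E]\cup[2\omega_0+\gamma,2\omega_1+\gamma]$ | $[\omega_0+E,\omega_1+E]\cup[2\omega_0+\gamma,\omega_1+F]$ | $[\omega_0+E,\omega_1+E]\cup[2\omega_0+\gamma,2\omega_1+\gamma]\cup[\omega_0+F,\omega_1+F]$ | The intervals in each entry are pairwise disjoint: $\omega_1+E<2\omega_0+\gamma$ in case (L2), and $2\omega_1+\gamma<\omega_0+F$ in case (U2). -/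

import Mathlib

open MeasureTheory Set
open scoped ENNReal NNReal ComplexConjugate

noncomputable section

namespace SpinBoson

/-! ### Bounded operators on `L²` given by a formula on representatives -/

/-- The formula `F`, acting on functions, induces an everywhere defined bounded linear operator
from `L²(μ)` to `L²(ν)`. -/
structure IsL2Bounded {X Y : Type*} [MeasurableSpace X] [MeasurableSpace Y]
    (μ : Measure X) (ν : Measure Y) (F : (X → ℂ) → (Y → ℂ)) : Prop where
  congr : ∀ f g : X → ℂ, f =ᵐ[μ] g → F f =ᵐ[ν] F g
  add : ∀ f g : X → ℂ, MemLp f 2 μ → MemLp g 2 μ → F (f + g) =ᵐ[ν] F f + F g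
  smul : ∀ (c : ℂ) (f : X → ℂ), MemLp f 2 μ → F (c • f) =ᵐ[ν] c • F f
  meas : ∀ f : X → ℂ, MemLp f 2 μ → AEStronglyMeasurable (F f) ν
  bound : ∃ C : ℝ≥0, ∀ f : X → ℂ, MemLp f 2 μ → eLpNorm (F f) 2 ν ≤ C * eLpNorm f 2 μ

theorem IsL2Bounded.memLp {X Y : Type*} [MeasurableSpace X] [MeasurableSpace Y]
    {μ : Measure X} {ν : Measure Y} {F : (X → ℂ) → (Y → ℂ)} (h : IsL2Bounded μ ν F)
    (f : X → ℂ) (hf : MemLp f 2 μ) : MemLp (F f) 2 ν := by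
  obtain ⟨C, hC⟩ := h.bound
  exact ⟨h.meas f hf, (hC f hf).trans_lt (ENNReal.mul_lt_top ENNReal.coe_lt_top hf.2)⟩

/-- The bounded operator `L²(μ) → L²(ν)`, `f ↦ F f`. -/
def l2Op {X Y : Type*} [MeasurableSpace X] [MeasurableSpace Y]
    {μ : Measure X} {ν : Measure Y} {F : (X → ℂ) → (Y → ℂ)} (h : IsL2Bounded μ ν F) :
    Lp ℂ 2 μ →L[ℂ] Lp ℂ 2 ν :=
  LinearMap.mkContinuousOfExistsBound
    { toFun := fun f => (h.memLp f (Lp.memLp f)).toLp (F f)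
      map_add' := by
        intro f g
        rw [← MemLp.toLp_add]
        apply MemLp.toLp_congr
        exact (h.congr _ _ (Lp.coeFn_add f g)).trans (h.add _ _ (Lp.memLp f) (Lp.memLp g))
      map_smul' := by
        intro c f
        rw [RingHom.id_apply, ← MemLp.toLp_const_smul]
        apply MemLp.toLp_congr
        exact (h.congr _ _ (Lp.coeFn_smul c f)).trans (h.smul c _ (Lp.memLp f)) }
    (by
      obtain ⟨C, hC⟩ := h.bound
      refine ⟨C, fun f => ?_⟩
      change ‖(h.memLp f (Lp.memLp f)).toLp (F f)‖ ≤ C * ‖f‖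
      rw [Lp.norm_toLp, Lp.norm_def]
      have := ENNReal.toReal_mono
        (ENNReal.mul_ne_top ENNReal.coe_ne_top (Lp.memLp f).2.ne) (hC f (Lp.memLp f))
      simpa [ENNReal.toReal_mul] using this)

theorem l2Op_coeFn {X Y : Type*} [MeasurableSpace X] [MeasurableSpace Y]
    {μ : Measure X} {ν : Measure Y} {F : (X → ℂ) → (Y → ℂ)} (h : IsL2Bounded μ ν F)
    (f : Lp ℂ 2 μ) : l2Op h f =ᵐ[ν] F f :=
  (h.memLp f (Lp.memLp f)).coeFn_toLp

/-- Multiplication by a bounded measurable function is bounded on `L²`. -/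
theorem isL2Bounded_mul {X : Type*} [MeasurableSpace X] {μ : Measure X} (m : X → ℂ)
    (hm : AEStronglyMeasurable m μ) (hb : ∃ C : ℝ, ∀ x, ‖m x‖ ≤ C) :
    IsL2Bounded μ μ (fun f x => m x * f x) where
  congr f g h := by filter_upwards [h] with x hx; simp [hx]
  add f g _ _ := by filter_upwards with x; simp [mul_add]
  smul c f _ := by filter_upwards with x; simp; ring
  meas f hf := hm.mul hf.1
  bound := by
    obtain ⟨C, hC⟩ := hb
    refine ⟨C.toNNReal, fun f _ => ?_⟩
    have := eLpNorm_le_nnreal_smul_eLpNorm_of_ae_le_mul (μ := μ)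
      (f := fun x => m x * f x) (g := f) (c := C.toNNReal) (Filter.Eventually.of_forall fun x => by
        rw [nnnorm_mul]
        gcongr
        exact NNReal.coe_le_coe.1 (by simpa using Or.inl (hC x))) 2
    simpa [ENNReal.smul_def] using this

/-! ### The spaces -/

/-- `ℝ^d`. -/
abbrev Rd (d : ℕ) : Type := EuclideanSpace ℝ (Fin d)

/-- Half of the Lebesgue measure on `ℝ^d × ℝ^d`; the inner product of its `L²` space is `1/2` times
the usual one. -/
def halfVol (d : ℕ) : Measure (Rd d × Rd d) := (2⁻¹ : ℝ≥0∞) • (volume : Measure (Rd d × Rd d))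

theorem ae_halfVol {d : ℕ} {p : Rd d × Rd d → Prop} :
    (∀ᵐ x ∂(halfVol d), p x) ↔ ∀ᵐ x ∂(volume : Measure (Rd d × Rd d)), p x := by
  unfold halfVol
  rw [Measure.ae_ennreal_smul_measure_iff (by simp)]

/-- `L²(ℝ^d)`. -/
abbrev L2 (d : ℕ) : Type := Lp ℂ 2 (volume : Measure (Rd d))

/-- `L²_s(ℝ^d × ℝ^d)`: the symmetric functions in `L²(ℝ^d × ℝ^d)`, with `1/2` times the usual
inner product. -/
def L2s (d : ℕ) : Submodule ℂ (Lp ℂ 2 (halfVol d)) where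
  carrier := {g | ∀ᵐ p ∂(volume : Measure (Rd d × Rd d)), g p.swap = g p}
  zero_mem' := by
    have h : ∀ᵐ p ∂(volume : Measure (Rd d × Rd d)), (0 : Lp ℂ 2 (halfVol d)) p = 0 :=
      ae_halfVol.1 (Lp.coeFn_zero ℂ 2 (halfVol d))
    have h' := (Measure.measurePreserving_swap (μ := (volume : Measure (Rd d)))
      (ν := volume)).quasiMeasurePreserving.ae h
    filter_upwards [h, h'] with p hp hp'
    rw [hp, hp']
  add_mem' := by
    intro f g hf hg
    have h : ∀ᵐ p ∂(volume : Measure (Rd d × Rd d)), (f + g) p = f p + g p :=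
      ae_halfVol.1 (Lp.coeFn_add f g)
    have h' := (Measure.measurePreserving_swap (μ := (volume : Measure (Rd d)))
      (ν := volume)).quasiMeasurePreserving.ae h
    change ∀ᵐ p ∂(volume : Measure (Rd d × Rd d)), _
    filter_upwards [h, h', hf, hg] with p hp hp' h1 h2
    rw [hp, hp', h1, h2]
  smul_mem' := by
    intro c f hf
    have h : ∀ᵐ p ∂(volume : Measure (Rd d × Rd d)), (c • f) p = c • f p :=
      ae_halfVol.1 (Lp.coeFn_smul c f)
    have h' := (Measure.measurePreserving_swap (μ := (volume : Measure (Rd d)))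
      (ν := volume)).quasiMeasurePreserving.ae h
    change ∀ᵐ p ∂(volume : Measure (Rd d × Rd d)), _
    filter_upwards [h, h', hf] with p hp hp' h1
    rw [hp, hp', h1]

/-- The Hilbert space `L²(ℝ^d) ⊕ L²_s(ℝ^d × ℝ^d)`. -/
abbrev Hil (d : ℕ) : Type := WithLp 2 (L2 d × L2s d)

/-! ### The entries of the operator matrix, as formulas -/

/-- `(A f)(k) = (-γ + ω(k)) f(k)`. -/
def fnA {d : ℕ} (ω : Rd d → ℝ) (γ : ℝ) (f : Rd d → ℂ) : Rd d → ℂ :=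
  fun k => ((-γ + ω k : ℝ) : ℂ) * f k

/-- `(B g)(k) = α ∫ g(k,q) λ(q) dq`. -/
def fnB {d : ℕ} (lam : Rd d → ℂ) (α : ℝ) (g : Rd d × Rd d → ℂ) : Rd d → ℂ :=
  fun k => (α : ℂ) * ∫ q, g (k, q) * lam q

/-- `(C f)(k,q) = α conj(λ(k)) f(q) + α conj(λ(q)) f(k)`. -/
def fnC {d : ℕ} (lam : Rd d → ℂ) (α : ℝ) (f : Rd d → ℂ) : Rd d × Rd d → ℂ :=
  fun p => (α : ℂ) * conj (lam p.1) * f p.2 + (α : ℂ) * conj (lam p.2) * f p.1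

/-- `(D g)(k,q) = (γ + ω(k) + ω(q)) g(k,q)`. -/
def fnD {d : ℕ} (ω : Rd d → ℝ) (γ : ℝ) (g : Rd d × Rd d → ℂ) : Rd d × Rd d → ℂ :=
  fun p => ((γ + ω p.1 + ω p.2 : ℝ) : ℂ) * g p

theorem exists_abs_le {d : ℕ} {ω : Rd d → ℝ} (h0 : ∀ k, 0 ≤ ω k) (hb : BddAbove (range ω)) :
    ∃ M : ℝ, ∀ k, |ω k| ≤ M := by
  obtain ⟨M, hM⟩ := hb
  exact ⟨M, fun k => by rw [abs_of_nonneg (h0 k)]; exact hM ⟨k, rfl⟩⟩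

theorem isL2Bounded_fnA {d : ℕ} {ω : Rd d → ℝ} (h0 : ∀ k, 0 ≤ ω k) (hc : Continuous ω)
    (hb : BddAbove (range ω)) (γ : ℝ) : IsL2Bounded volume volume (fnA ω γ) := by
  refine isL2Bounded_mul _ (Continuous.aestronglyMeasurable (by fun_prop)) ?_
  obtain ⟨M, hM⟩ := exists_abs_le h0 hb
  refine ⟨|γ| + M, fun k => ?_⟩
  rw [Complex.norm_real, Real.norm_eq_abs]
  have := abs_add_le (-γ) (ω k)
  rw [abs_neg] at this
  linarith [hM k]

theorem isL2Bounded_fnD {d : ℕ} {ω : Rd d → ℝ} (h0 : ∀ k, 0 ≤ ω k) (hc : Continuous ω)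
    (hb : BddAbove (range ω)) (γ : ℝ) : IsL2Bounded (halfVol d) (halfVol d) (fnD ω γ) := by
  refine isL2Bounded_mul _ (Continuous.aestronglyMeasurable (by fun_prop)) ?_
  obtain ⟨M, hM⟩ := exists_abs_le h0 hb
  refine ⟨|γ| + M + M, fun p => ?_⟩
  rw [Complex.norm_real, Real.norm_eq_abs]
  have := abs_add_le (γ + ω p.1) (ω p.2)
  have := abs_add_le γ (ω p.1)
  linarith [hM p.1, hM p.2]

theorem eLpNorm_two_sq {X : Type*} [MeasurableSpace X] (μ : Measure X) (f : X → ℂ) :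
    eLpNorm f 2 μ ^ 2 = ∫⁻ x, ‖f x‖ₑ ^ 2 ∂μ := by
  have := eLpNorm_nnreal_pow_eq_lintegral (μ := μ) (f := f) (p := 2) (by norm_num)
  simpa using this

theorem eLpNorm_halfVol_sq {d : ℕ} (g : Rd d × Rd d → ℂ) :
    ∫⁻ p, ‖g p‖ₑ ^ 2 ∂(volume : Measure (Rd d × Rd d)) = 2 * eLpNorm g 2 (halfVol d) ^ 2 := by
  rw [eLpNorm_two_sq, halfVol, lintegral_smul_measure, smul_eq_mul, ← mul_assoc,
    ENNReal.mul_inv_cancel (by simp) (by simp), one_mul]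

theorem memLp_volume_of_halfVol {d : ℕ} {g : Rd d × Rd d → ℂ} (hg : MemLp g 2 (halfVol d)) :
    MemLp g 2 (volume : Measure (Rd d × Rd d)) := by
  have h : (volume : Measure (Rd d × Rd d)) = (2 : ℝ≥0∞) • halfVol d := by
    rw [halfVol, smul_smul, ENNReal.mul_inv_cancel (by simp) (by simp), one_smul]
  rw [h]
  exact hg.smul_measure (by simp)

theorem memLp_section {d : ℕ} {g : Rd d × Rd d → ℂ} (hg : MemLp g 2 (halfVol d)) :
    ∀ᵐ k ∂(volume : Measure (Rd d)), MemLp (fun q => g (k, q)) 2 volume := by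
  have hg' := memLp_volume_of_halfVol hg
  have hm : AEMeasurable (fun p => ‖g p‖ₑ ^ 2) (volume : Measure (Rd d × Rd d)) :=
    hg'.1.enorm.pow_const 2
  have hfin : ∫⁻ k, ∫⁻ q, ‖g (k, q)‖ₑ ^ 2 ∂(volume : Measure (Rd d))
      ∂(volume : Measure (Rd d)) ≠ ∞ := by
    rw [← lintegral_prod _ hm]
    rw [← Measure.volume_eq_prod, ← eLpNorm_two_sq]
    exact (ENNReal.pow_lt_top hg'.2).ne
  have h1 := ae_lt_top' (AEMeasurable.lintegral_prod_right' hm) hfin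
  have h2 := AEStronglyMeasurable.prodMk_left (μ := (volume : Measure (Rd d)))
    (ν := (volume : Measure (Rd d))) hg'.1
  filter_upwards [h1, h2] with k hk1 hk2
  refine ⟨hk2, ?_⟩
  by_contra hcon
  rw [not_lt, top_le_iff] at hcon
  rw [← eLpNorm_two_sq, hcon] at hk1
  simp at hk1

theorem enorm_integral_mul_sq_le {d : ℕ} {u v : Rd d → ℂ} (hu : MemLp u 2 volume)
    (hv : MemLp v 2 volume) :
    ‖∫ q, u q * v q‖ₑ ^ 2 ≤ (∫⁻ q, ‖u q‖ₑ ^ 2) * eLpNorm v 2 volume ^ 2 := by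
  rw [← eLpNorm_two_sq, ← mul_pow]
  gcongr
  refine (enorm_integral_le_lintegral_enorm _).trans ?_
  rw [← eLpNorm_one_eq_lintegral_enorm]
  have h : eLpNorm (u • v) 1 volume ≤ eLpNorm u 2 volume * eLpNorm v 2 volume :=
    eLpNorm_smul_le_mul_eLpNorm hv.1 hu.1
  exact h

theorem isL2Bounded_fnB {d : ℕ} {lam : Rd d → ℂ} (hl : MemLp lam 2 volume) (α : ℝ) :
    IsL2Bounded (halfVol d) volume (fnB lam α) where
  congr f g h := by
    have h' : ∀ᵐ p ∂((volume : Measure (Rd d)).prod (volume : Measure (Rd d))), f p = g p :=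
      ae_halfVol.1 h
    filter_upwards [Measure.ae_ae_of_ae_prod h'] with k hk
    simp only [fnB]
    congr 1
    apply integral_congr_ae
    filter_upwards [hk] with q hq
    rw [hq]
  add f g hf hg := by
    filter_upwards [memLp_section hf, memLp_section hg] with k hk1 hk2
    simp only [fnB, Pi.add_apply, add_mul]
    have i1 : Integrable (fun q => f (k, q) * lam q) volume := hk1.integrable_mul hl
    have i2 : Integrable (fun q => g (k, q) * lam q) volume := hk2.integrable_mul hl
    rw [integral_add i1 i2, mul_add]
  smul c f _ := by
    filter_upwards with k
    simp only [fnB, Pi.smul_apply, smul_eq_mul, mul_assoc]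
    rw [integral_const_mul]
    ring
  meas f hf := by
    have hf' := (memLp_volume_of_halfVol hf).1
    have h : AEStronglyMeasurable (fun p : Rd d × Rd d => f p * lam p.2)
        ((volume : Measure (Rd d)).prod (volume : Measure (Rd d))) :=
      AEStronglyMeasurable.mul hf' hl.1.comp_snd
    exact h.integral_prod_right'.const_mul _
  bound := by
    refine ⟨(ENNReal.ofReal |α| * 2 * eLpNorm lam 2 volume).toNNReal, fun f hf => ?_⟩
    rw [ENNReal.coe_toNNReal (ENNReal.mul_ne_top (by finiteness) hl.2.ne)]
    rw [← ENNReal.pow_le_pow_left_iff (n := 2) (by norm_num), eLpNorm_two_sq]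
    have hm : AEMeasurable (fun p => ‖f p‖ₑ ^ 2) (volume : Measure (Rd d × Rd d)) :=
      (memLp_volume_of_halfVol hf).1.enorm.pow_const 2
    calc ∫⁻ k, ‖fnB lam α f k‖ₑ ^ 2
        ≤ ∫⁻ k, ENNReal.ofReal |α| ^ 2 * eLpNorm lam 2 volume ^ 2 * ∫⁻ q, ‖f (k, q)‖ₑ ^ 2 := by
          apply lintegral_mono_ae
          filter_upwards [memLp_section hf] with k hk
          simp only [fnB]
          rw [enorm_mul, mul_pow, mul_assoc, mul_comm (eLpNorm lam 2 volume ^ 2)]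
          have hα : ‖(α : ℂ)‖ₑ = ENNReal.ofReal |α| := by
            rw [← ofReal_norm, Complex.norm_real, Real.norm_eq_abs]
          rw [hα]
          gcongr
          exact enorm_integral_mul_sq_le hk hl
      _ = ENNReal.ofReal |α| ^ 2 * eLpNorm lam 2 volume ^ 2 *
            (2 * eLpNorm f 2 (halfVol d) ^ 2) := by
          rw [lintegral_const_mul'' _ (AEMeasurable.lintegral_prod_right' hm),
            ← eLpNorm_halfVol_sq, Measure.volume_eq_prod, lintegral_prod _ hm]
      _ ≤ (ENNReal.ofReal |α| * 2 * eLpNorm lam 2 volume * eLpNorm f 2 (halfVol d)) ^ 2 := by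
          rw [mul_pow, mul_pow, mul_pow]
          calc _ = ENNReal.ofReal |α| ^ 2 * 2 * eLpNorm lam 2 volume ^ 2 *
                eLpNorm f 2 (halfVol d) ^ 2 := by ring
            _ ≤ _ := by
              gcongr
              norm_num

theorem eLpNorm_tensor {d : ℕ} {u v : Rd d → ℂ} (hu : AEStronglyMeasurable u volume)
    (hv : AEStronglyMeasurable v volume) :
    eLpNorm (fun p : Rd d × Rd d => u p.1 * v p.2) 2 (halfVol d) ≤
      eLpNorm u 2 volume * eLpNorm v 2 volume := by
  have h1 : eLpNorm (fun p : Rd d × Rd d => u p.1 * v p.2) 2 (halfVol d) ≤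
      eLpNorm (fun p : Rd d × Rd d => u p.1 * v p.2) 2 volume := by
    apply eLpNorm_mono_measure
    intro s
    simp only [halfVol, Measure.smul_apply, smul_eq_mul]
    exact mul_le_of_le_one_left (by simp) (by simp)
  refine h1.trans ?_
  rw [← ENNReal.pow_le_pow_left_iff (n := 2) (by norm_num), mul_pow, eLpNorm_two_sq,
    eLpNorm_two_sq, eLpNorm_two_sq]
  simp only [enorm_mul, mul_pow]
  rw [Measure.volume_eq_prod, lintegral_prod_mul (hu.enorm.pow_const 2) (hv.enorm.pow_const 2)]

theorem isL2Bounded_fnC {d : ℕ} {lam : Rd d → ℂ} (hl : MemLp lam 2 volume) (α : ℝ) :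
    IsL2Bounded volume (halfVol d) (fnC lam α) where
  congr f g h := by
    have h1 : ∀ᵐ p ∂(volume : Measure (Rd d × Rd d)), f p.1 = g p.1 :=
      (Measure.quasiMeasurePreserving_fst (μ := (volume : Measure (Rd d)))
        (ν := (volume : Measure (Rd d)))).ae h
    have h2 : ∀ᵐ p ∂(volume : Measure (Rd d × Rd d)), f p.2 = g p.2 :=
      (Measure.quasiMeasurePreserving_snd (μ := (volume : Measure (Rd d)))
        (ν := (volume : Measure (Rd d)))).ae h
    refine ae_halfVol.2 ?_
    filter_upwards [h1, h2] with p hp1 hp2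
    simp only [fnC, hp1, hp2]
  add f g _ _ := by filter_upwards with p; simp only [fnC, Pi.add_apply]; ring
  smul c f _ := by filter_upwards with p; simp only [fnC, Pi.smul_apply, smul_eq_mul]; ring
  meas f hf := by
    have hl' : AEStronglyMeasurable (fun k => conj (lam k)) volume :=
      Complex.continuous_conj.comp_aestronglyMeasurable hl.1
    have h : AEStronglyMeasurable (fnC lam α f)
        ((volume : Measure (Rd d)).prod (volume : Measure (Rd d))) :=
      (((hl'.comp_fst).const_mul _).mul hf.1.comp_snd).add
        (((hl'.comp_snd).const_mul _).mul hf.1.comp_fst)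
    exact h.smul_measure _
  bound := by
    have hl' : MemLp (fun k => (α : ℂ) * conj (lam k)) 2 volume :=
      (MemLp.of_le hl (Complex.continuous_conj.comp_aestronglyMeasurable hl.1)
        (by simp)).const_mul _
    set c := eLpNorm (fun k => (α : ℂ) * conj (lam k)) 2 volume with hc
    refine ⟨(2 * c).toNNReal, fun f hf => ?_⟩
    rw [ENNReal.coe_toNNReal (ENNReal.mul_ne_top (by simp) hl'.2.ne)]
    have e1 := eLpNorm_tensor hl'.1 hf.1
    have e2 := eLpNorm_tensor hf.1 hl'.1
    have m1 : AEStronglyMeasurable (fun p : Rd d × Rd d => (α : ℂ) * conj (lam p.1) * f p.2)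
        (halfVol d) := by
      have h : AEStronglyMeasurable (fun p : Rd d × Rd d => (α : ℂ) * conj (lam p.1) * f p.2)
          ((volume : Measure (Rd d)).prod (volume : Measure (Rd d))) :=
        hl'.1.comp_fst.mul hf.1.comp_snd
      exact h.smul_measure _
    have m2 : AEStronglyMeasurable (fun p : Rd d × Rd d => f p.1 * ((α : ℂ) * conj (lam p.2)))
        (halfVol d) := by
      have h : AEStronglyMeasurable
          (fun p : Rd d × Rd d => f p.1 * ((α : ℂ) * conj (lam p.2)))
          ((volume : Measure (Rd d)).prod (volume : Measure (Rd d))) :=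
        hf.1.comp_fst.mul hl'.1.comp_snd
      exact h.smul_measure _
    have hsum : fnC lam α f = (fun p : Rd d × Rd d => (α : ℂ) * conj (lam p.1) * f p.2) +
        (fun p : Rd d × Rd d => f p.1 * ((α : ℂ) * conj (lam p.2))) := by
      funext p
      simp only [fnC, Pi.add_apply]
      ring
    rw [hsum]
    refine (eLpNorm_add_le m1 m2 (by norm_num)).trans ((add_le_add e1 e2).trans ?_)
    rw [← hc, mul_comm (eLpNorm f 2 volume) c, two_mul, add_mul]

/-! ### The operator matrix -/

/-- `A` on `L²(ℝ^d)`. -/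
def opA {d : ℕ} {ω : Rd d → ℝ} (h0 : ∀ k, 0 ≤ ω k) (hc : Continuous ω)
    (hb : BddAbove (range ω)) (γ : ℝ) : L2 d →L[ℂ] L2 d :=
  l2Op (isL2Bounded_fnA h0 hc hb γ)

/-- `B` from `L²_s(ℝ^d × ℝ^d)` to `L²(ℝ^d)`. -/
def opB {d : ℕ} {lam : Rd d → ℂ} (hl : MemLp lam 2 volume) (α : ℝ) : L2s d →L[ℂ] L2 d :=
  (l2Op (isL2Bounded_fnB hl α)).comp (L2s d).subtypeL

/-- `C` from `L²(ℝ^d)` to `L²_s(ℝ^d × ℝ^d)`. -/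
def opC {d : ℕ} {lam : Rd d → ℂ} (hl : MemLp lam 2 volume) (α : ℝ) : L2 d →L[ℂ] L2s d :=
  (l2Op (isL2Bounded_fnC hl α)).codRestrict (L2s d) (by
    intro f
    have h : ∀ᵐ p ∂(volume : Measure (Rd d × Rd d)),
        l2Op (isL2Bounded_fnC hl α) f p = fnC lam α f p :=
      ae_halfVol.1 (l2Op_coeFn (isL2Bounded_fnC hl α) f)
    have h' := (Measure.measurePreserving_swap (μ := (volume : Measure (Rd d)))
      (ν := volume)).quasiMeasurePreserving.ae h
    change ∀ᵐ p ∂(volume : Measure (Rd d × Rd d)), _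
    filter_upwards [h, h'] with p hp hp'
    rw [hp, hp']
    simp only [fnC, Prod.fst_swap, Prod.snd_swap]
    ring)

/-- `D` on `L²_s(ℝ^d × ℝ^d)`. -/
def opD {d : ℕ} {ω : Rd d → ℝ} (h0 : ∀ k, 0 ≤ ω k) (hc : Continuous ω)
    (hb : BddAbove (range ω)) (γ : ℝ) : L2s d →L[ℂ] L2s d :=
  (l2Op (isL2Bounded_fnD h0 hc hb γ)).restrict (by
    intro g hg
    have h : ∀ᵐ p ∂(volume : Measure (Rd d × Rd d)),
        l2Op (isL2Bounded_fnD h0 hc hb γ) g p = fnD ω γ g p :=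
      ae_halfVol.1 (l2Op_coeFn (isL2Bounded_fnD h0 hc hb γ) g)
    have h' := (Measure.measurePreserving_swap (μ := (volume : Measure (Rd d)))
      (ν := volume)).quasiMeasurePreserving.ae h
    have hg' : ∀ᵐ p ∂(volume : Measure (Rd d × Rd d)), g p.swap = g p := hg
    change ∀ᵐ p ∂(volume : Measure (Rd d × Rd d)), _
    filter_upwards [h, h', hg'] with p hp hp' hgp
    change l2Op (isL2Bounded_fnD h0 hc hb γ) g p.swap = l2Op (isL2Bounded_fnD h0 hc hb γ) g p
    rw [hp, hp']
    simp only [fnD, Prod.fst_swap, Prod.snd_swap, hgp]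
    push_cast
    ring)

/-- The reduced operator matrix `𝒜 = (A B; C D)`, i.e. `𝒜 (f, g) = (A f + B g, C f + D g)`. -/
def opMatrix {d : ℕ} {ω : Rd d → ℝ} (h0 : ∀ k, 0 ≤ ω k) (hc : Continuous ω)
    (hb : BddAbove (range ω)) {lam : Rd d → ℂ} (hl : MemLp lam 2 volume) (γ α : ℝ) :
    Hil d →L[ℂ] Hil d :=
  ((WithLp.prodContinuousLinearEquiv 2 ℂ (L2 d) (L2s d)).symm : L2 d × L2s d →L[ℂ] Hil d) ∘L
    (((opA h0 hc hb γ).coprod (opB hl α)).prod ((opC hl α).coprod (opD h0 hc hb γ))) ∘L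
    ((WithLp.prodContinuousLinearEquiv 2 ℂ (L2 d) (L2s d)) : Hil d →L[ℂ] L2 d × L2s d)

/-- The essential spectrum of a bounded operator: all `z` for which `T - z` is not Fredholm. -/
def essSpectrum {H : Type*} [NormedAddCommGroup H] [NormedSpace ℂ H] (T : H →L[ℂ] H) : Set ℂ :=
  {z | ¬ (T - z • ContinuousLinearMap.id ℂ H).IsFredholm}

/-- The essential spectrum of the operator matrix `𝒜`. -/
def essSpectrumA {d : ℕ} {ω : Rd d → ℝ} (h0 : ∀ k, 0 ≤ ω k) (hc : Continuous ω)
    (hb : BddAbove (range ω)) {lam : Rd d → ℂ} (hl : MemLp lam 2 volume) (γ α : ℝ) : Set ℂ :=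
  essSpectrum (H := Hil d) (opMatrix h0 hc hb hl γ α)

/-! ### The function `Φ`, its zeros and the critical couplings -/

/-- `ω₀ = inf ω`. -/
def omega0 {d : ℕ} (ω : Rd d → ℝ) : ℝ := ⨅ k, ω k

/-- `ω₁ = sup ω`. -/
def omega1 {d : ℕ} (ω : Rd d → ℝ) : ℝ := ⨆ k, ω k

/-- `Φ(z) = -γ - z - α² ∫ |λ(q)|² / (ω(q) + γ - z) dq`; it is used only for
`z < ω₀ + γ` and for `z > ω₁ + γ`, where the integrand is integrable. -/
def Phi {d : ℕ} (ω : Rd d → ℝ) (lam : Rd d → ℂ) (γ α z : ℝ) : ℝ :=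
  -γ - z - α ^ 2 * ∫ q, ‖lam q‖ ^ 2 / (ω q + γ - z)

/-- `E` is the unique zero of `Φ` in `(-∞, ω₀ + γ)`. -/
def IsLowerZero {d : ℕ} (ω : Rd d → ℝ) (lam : Rd d → ℂ) (γ α E : ℝ) : Prop :=
  E < omega0 ω + γ ∧ Phi ω lam γ α E = 0 ∧
    ∀ z, z < omega0 ω + γ → Phi ω lam γ α z = 0 → z = E

/-- `F` is the unique zero of `Φ` in `(ω₁ + γ, ∞)`. -/
def IsUpperZero {d : ℕ} (ω : Rd d → ℝ) (lam : Rd d → ℂ) (γ α F : ℝ) : Prop :=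
  omega1 ω + γ < F ∧ Phi ω lam γ α F = 0 ∧
    ∀ z, omega1 ω + γ < z → Phi ω lam γ α z = 0 → z = F

/-- `‖λ/√w‖²` in `L²(ℝ^d)`, with value `∞` if `λ/√w` is not in `L²` (for instance if
`w` vanishes on a set of positive measure on which `λ ≠ 0`); here `w ≥ 0`. -/
def weightedSq {d : ℕ} (lam : Rd d → ℂ) (w : Rd d → ℝ) : ℝ≥0∞ :=
  ∫⁻ q, ‖lam q‖ₑ ^ 2 / ENNReal.ofReal (w q)

/-- `‖λ/√w‖` in `L²(ℝ^d)`, if this is finite. -/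
def weightedNorm {d : ℕ} (lam : Rd d → ℂ) (w : Rd d → ℝ) : ℝ := √(weightedSq lam w).toReal

/-- `λ/√(ω - ω₀) ∈ L²(ℝ^d)`. -/
def RegularLow {d : ℕ} (ω : Rd d → ℝ) (lam : Rd d → ℂ) : Prop :=
  weightedSq lam (fun q => ω q - omega0 ω) < ∞

/-- `λ/√(ω₁ - ω) ∈ L²(ℝ^d)`. -/
def RegularHigh {d : ℕ} (ω : Rd d → ℝ) (lam : Rd d → ℂ) : Prop :=
  weightedSq lam (fun q => omega1 ω - ω q) < ∞

/-- `α₁ = √(-2γ - ω₀) / ‖λ/√(ω - ω₀)‖`, used when `γ ≤ -ω₀/2` and `λ/√(ω - ω₀) ∈ L²`. -/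
def alpha1 {d : ℕ} (ω : Rd d → ℝ) (lam : Rd d → ℂ) (γ : ℝ) : ℝ :=
  √(-2 * γ - omega0 ω) / weightedNorm lam (fun q => ω q - omega0 ω)

/-- `α₂ = √(ω₁ - 2ω₀ - 2γ) / ‖λ/√(ω₁ - 2ω₀ + ω)‖`, used when `γ ≤ ω₁/2 - ω₀`. -/
def alpha2 {d : ℕ} (ω : Rd d → ℝ) (lam : Rd d → ℂ) (γ : ℝ) : ℝ :=
  √(omega1 ω - 2 * omega0 ω - 2 * γ) /
    weightedNorm lam (fun q => omega1 ω - 2 * omega0 ω + ω q)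

/-- `α₃ = √(ω₁ + 2γ) / ‖λ/√(ω₁ - ω)‖`, used when `γ ≥ -ω₁/2` and `λ/√(ω₁ - ω) ∈ L²`. -/
def alpha3 {d : ℕ} (ω : Rd d → ℝ) (lam : Rd d → ℂ) (γ : ℝ) : ℝ :=
  √(omega1 ω + 2 * γ) / weightedNorm lam (fun q => omega1 ω - ω q)

/-- `α₄ = √(2ω₁ - ω₀ + 2γ) / ‖λ/√(2ω₁ - ω₀ - ω)‖`, used when `γ ≥ ω₀/2 - ω₁`. -/
def alpha4 {d : ℕ} (ω : Rd d → ℝ) (lam : Rd d → ℂ) (γ : ℝ) : ℝ :=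
  √(2 * omega1 ω - omega0 ω + 2 * γ) /
    weightedNorm lam (fun q => 2 * omega1 ω - omega0 ω - ω q)

/-! ### Position of `γ` and `α` relative to the critical couplings -/

/-- The parameter range with no branch below `2ω₀ + γ`:
`λ/√(ω - ω₀) ∈ L²`, `γ ≤ -ω₀/2` and `α ≤ α₁`. -/
def LowAbsent {d : ℕ} (ω : Rd d → ℝ) (lam : Rd d → ℂ) (γ α : ℝ) : Prop :=
  RegularLow ω lam ∧ γ ≤ -omega0 ω / 2 ∧ α ≤ alpha1 ω lam γ

/-- The parameter range with a branch below `2ω₀ + γ` that is attached to `[2ω₀ + γ, 2ω₁ + γ]`: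
not the range with no lower branch, `γ ≤ ω₁/2 - ω₀` and `α ≤ α₂`. -/
def LowAttached {d : ℕ} (ω : Rd d → ℝ) (lam : Rd d → ℂ) (γ α : ℝ) : Prop :=
  ¬ LowAbsent ω lam γ α ∧ γ ≤ omega1 ω / 2 - omega0 ω ∧ α ≤ alpha2 ω lam γ

/-- The parameter range with a branch separated by a gap below `2ω₀ + γ`:
`γ > ω₁/2 - ω₀`, or `γ ≤ ω₁/2 - ω₀` and `α > α₂`. -/
def LowDetached {d : ℕ} (ω : Rd d → ℝ) (lam : Rd d → ℂ) (γ α : ℝ) : Prop :=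
  omega1 ω / 2 - omega0 ω < γ ∨ (γ ≤ omega1 ω / 2 - omega0 ω ∧ alpha2 ω lam γ < α)

/-- The parameter range with no branch above `2ω₁ + γ`:
`λ/√(ω₁ - ω) ∈ L²`, `γ ≥ -ω₁/2` and `α ≤ α₃`. -/
def HighAbsent {d : ℕ} (ω : Rd d → ℝ) (lam : Rd d → ℂ) (γ α : ℝ) : Prop :=
  RegularHigh ω lam ∧ -omega1 ω / 2 ≤ γ ∧ α ≤ alpha3 ω lam γ

/-- The parameter range with a branch above `2ω₁ + γ` that is attached to `[2ω₀ + γ, 2ω₁ + γ]`: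
not the range with no upper branch, `γ ≥ ω₀/2 - ω₁` and `α ≤ α₄`. -/
def HighAttached {d : ℕ} (ω : Rd d → ℝ) (lam : Rd d → ℂ) (γ α : ℝ) : Prop :=
  ¬ HighAbsent ω lam γ α ∧ omega0 ω / 2 - omega1 ω ≤ γ ∧ α ≤ alpha4 ω lam γ

/-- The parameter range with a branch separated by a gap above `2ω₁ + γ`:
`γ < ω₀/2 - ω₁`, or `γ ≥ ω₀/2 - ω₁` and `α > α₄`. -/
def HighDetached {d : ℕ} (ω : Rd d → ℝ) (lam : Rd d → ℂ) (γ α : ℝ) : Prop :=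
  γ < omega0 ω / 2 - omega1 ω ∨ (omega0 ω / 2 - omega1 ω ≤ γ ∧ alpha4 ω lam γ < α)

end SpinBoson

end

open SpinBoson

/-!
The essential spectrum of `𝒜` is, for all values of the parameters, the union of the two-particle
interval `[2ω₀ + γ, 2ω₁ + γ]` and of the translates `[ω₀ + e, ω₁ + e]` by the zeros `e` of `Φ`
outside `[ω₀ + γ, ω₁ + γ]` (`essSpectrumA_eq`). The table of cases then records how many zeros
there are and where they lie.

*Points outside this union.* For such `z` the operator `D - z` is invertible, and the Schur
complement `A - z - B (D - z)⁻¹ C` is the multiplication by `Φ(z - ω(k))` plus the integral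
operator with kernel `-α² conj λ(k) λ(q) / (γ + ω(k) + ω(q) - z)`. The multiplication part is
bounded away from zero: for real `z` because `Φ` has no zero in the compact interval `[z - ω₁, z -
ω₀]`, for nonreal `z` because its imaginary part cannot cancel. The integral operator is a norm
limit of operators of finite rank, so that the Schur complement is invertible up to finite rank,
and an explicit quasi-inverse of the operator matrix exists (`isFredholm_blockOp`,
`isFredholm_of_le_norm`). This treats real and nonreal `z` alike and makes no use of
self-adjointness.

*Points of this union.* A Fredholm operator is bounded below on a subspace of finite codimension,
so it suffices to find, for each `ε`, an infinite-dimensional space on which `𝒜 - z` has norm at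
most `ε` (`not_isFredholm_of_small`). For `z = x + e` with `Φ(e) = 0` these are the states in
which one particle forms a bound state of energy `e` and a second one, orthogonal to `conj λ`, is
concentrated where `ω` is near `x` (`not_isFredholm_of_zero`); for `z` in the two-particle
interval both particles are concentrated where `ω` is near `(z - γ)/2`
(`not_isFredholm_of_mem_Icc`). Continuity of `ω` enters through the density of its values in `[ω₀,
ω₁]`.

*Zeros of `Φ`.* Below `ω₀ + γ` the function `Φ` is strictly decreasing from `+∞`, so the sign of
its limit at `ω₀ + γ` decides whether a zero exists (`lowAbsent_iff`), and its sign at `2ω₀ - ω₁ +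
γ` decides whether there is a gap (`Phi_nonneg_iff`). The statements above `ω₁ + γ` follow by
replacing `ω` with `ω₀ + ω₁ - ω` (`Phi_reflect`).
-/

/-! ### Fredholm criteria -/

open scoped LinearMap.FiniteRangeSetoid in
/-- Weyl's criterion in the direction that needs no self-adjointness: a Fredholm operator is bounded
below on a subspace of finite codimension, hence it cannot be arbitrarily small on subspaces of
infinite dimension. -/
theorem not_isFredholm_of_small {H : Type*} [NormedAddCommGroup H] [NormedSpace ℂ H]
    {u : H →L[ℂ] H} (h : ∀ ε > 0, ∃ W : Submodule ℂ H, ¬ FiniteDimensional ℂ W ∧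
      ∀ x ∈ W, ‖u x‖ ≤ ε * ‖x‖) : ¬ u.IsFredholm := by
  intro hu
  obtain ⟨v, hv⟩ := hu.exists_isQuasiInverse
  have h1 : (v.toLinearMap ∘ₗ u.toLinearMap - LinearMap.id).HasFiniteRange :=
    LinearMap.FiniteRangeSetoid.equiv_iff_hasFiniteRange.1 hv.1
  set P := v.toLinearMap ∘ₗ u.toLinearMap - LinearMap.id with hP
  obtain ⟨W, hW, hWu⟩ := h (1 / (‖v‖ + 1)) (by positivity)
  apply hW
  have hfin : FiniteDimensional ℂ P.range := Module.Finite.of_fg h1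
  refine Module.Finite.of_injective (P.rangeRestrict ∘ₗ W.subtype) ?_
  rw [← LinearMap.ker_eq_bot, LinearMap.ker_eq_bot']
  rintro ⟨x, hx⟩ hx0
  have hPx : P x = 0 := congrArg Subtype.val hx0
  have hvx : v (u x) = x := by
    simpa [hP, sub_eq_zero] using hPx
  have hle : ‖x‖ ≤ ‖v‖ * (1 / (‖v‖ + 1) * ‖x‖) := by
    calc ‖x‖ = ‖v (u x)‖ := by rw [hvx]
      _ ≤ ‖v‖ * ‖u x‖ := v.le_opNorm _
      _ ≤ _ := by gcongr; exact hWu x hx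
  have hlt : ‖v‖ * (1 / (‖v‖ + 1)) < 1 := by
    rw [mul_one_div, div_lt_one (by positivity)]
    linarith
  have hx' : ‖x‖ = 0 := by
    by_contra hne
    have hpos : 0 < ‖x‖ := lt_of_le_of_ne (norm_nonneg x) (Ne.symm hne)
    have := mul_lt_mul_of_pos_right hlt hpos
    linarith
  simpa using hx'

/-- The operator matrix `(A B; C D)` on the Hilbert direct sum of `X` and `Y`. -/
def blockOp {X Y : Type*} [NormedAddCommGroup X] [NormedSpace ℂ X] [NormedAddCommGroup Y]
    [NormedSpace ℂ Y] (A : X →L[ℂ] X) (B : Y →L[ℂ] X) (C : X →L[ℂ] Y) (D : Y →L[ℂ] Y) :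
    WithLp 2 (X × Y) →L[ℂ] WithLp 2 (X × Y) :=
  ((WithLp.prodContinuousLinearEquiv 2 ℂ X Y).symm : X × Y →L[ℂ] WithLp 2 (X × Y)) ∘L
    ((A.coprod B).prod (C.coprod D)) ∘L
    ((WithLp.prodContinuousLinearEquiv 2 ℂ X Y) : WithLp 2 (X × Y) →L[ℂ] X × Y)

section blockOp

variable {X Y : Type*} [NormedAddCommGroup X] [NormedSpace ℂ X] [NormedAddCommGroup Y]
  [NormedSpace ℂ Y] (A : X →L[ℂ] X) (B : Y →L[ℂ] X) (C : X →L[ℂ] Y) (D : Y →L[ℂ] Y)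

theorem blockOp_apply (x : WithLp 2 (X × Y)) :
    blockOp A B C D x = WithLp.toLp 2 (A x.fst + B x.snd, C x.fst + D x.snd) := rfl

theorem blockOp_toLp (x : X) (y : Y) :
    blockOp A B C D (WithLp.toLp 2 (x, y)) = WithLp.toLp 2 (A x + B y, C x + D y) := rfl

theorem norm_blockOp_inr_le {y : Y} {ε : ℝ} (hB : B y = 0) (hD : ‖D y‖ ≤ ε * ‖y‖) :
    ‖blockOp A B C D (WithLp.toLp 2 (0, y))‖ ≤ ε * ‖WithLp.toLp 2 ((0 : X), y)‖ := by
  rw [blockOp_toLp, map_zero, map_zero, hB, zero_add, zero_add, WithLp.norm_toLp_snd,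
    WithLp.norm_toLp_snd]
  exact hD

theorem blockOp_sub_smul_id (z : ℂ) :
    blockOp A B C D - z • ContinuousLinearMap.id ℂ (WithLp 2 (X × Y)) =
      blockOp (A - z • ContinuousLinearMap.id ℂ X) B C (D - z • ContinuousLinearMap.id ℂ Y) := by
  ext1 x
  apply (WithLp.prodContinuousLinearEquiv 2 ℂ X Y).injective
  ext1 <;> simp [blockOp_apply] <;> abel

open scoped LinearMap.FiniteRangeSetoid in
/-- If `D` is invertible with inverse `R` and the Schur complement `A - B R C` differs from an
invertible operator by one of finite rank, then the operator matrix is Fredholm. -/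
theorem isFredholm_blockOp {R : Y →L[ℂ] Y} (hRD : ∀ y, R (D y) = y) (hDR : ∀ y, D (R y) = y)
    {U : X →L[ℂ] X} (hU : IsUnit U)
    (hN : (A - B ∘L R ∘L C - U).toLinearMap.HasFiniteRange) :
    (blockOp A B C D).IsFredholm := by
  obtain ⟨⟨U, W, hUW, hWU⟩, rfl⟩ := hU
  have hUW' : ∀ x, U (W x) = x := fun x => DFunLike.congr_fun hUW x
  have hWU' : ∀ x, W (U x) = x := fun x => DFunLike.congr_fun hWU x
  set N : X →L[ℂ] X := A - B ∘L R ∘L C - U with hNdef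
  have hA : ∀ x, A x = U x + N x + B (R (C x)) := fun x => by simp [hNdef]
  -- the inverse of the matrix with upper left corner `A - N`
  let V := blockOp W (-(W ∘L B ∘L R)) (-(R ∘L C ∘L W)) (R + R ∘L C ∘L W ∘L B ∘L R)
  refine ContinuousLinearMap.IsFredholm.of_isQuasiInverse (v := V) ⟨?_, ?_⟩
  · let L : WithLp 2 (X × Y) →ₗ[ℂ] X := N.toLinearMap ∘ₗ LinearMap.fst ℂ X Y ∘ₗ
      (WithLp.prodContinuousLinearEquiv 2 ℂ X Y).toLinearMap
    refine LinearMap.FiniteRangeSetoid.equiv_of_eqOn_coFG (A := L.ker)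
      (LinearMap.ker_coFG_iff_hasFiniteRange.2 (hN.comp_right _)) fun x hx => ?_
    have hx' : N x.fst = 0 := hx
    apply (WithLp.prodContinuousLinearEquiv 2 ℂ X Y).injective
    ext1 <;> simp [V, blockOp_apply, hA, hx', hRD, hWU']
    abel
  · let L : WithLp 2 (X × Y) →ₗ[ℂ] X := N.toLinearMap ∘ₗ (W.toLinearMap ∘ₗ
      (LinearMap.fst ℂ X Y - (B ∘L R).toLinearMap ∘ₗ LinearMap.snd ℂ X Y) ∘ₗ
      (WithLp.prodContinuousLinearEquiv 2 ℂ X Y).toLinearMap)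
    refine LinearMap.FiniteRangeSetoid.equiv_of_eqOn_coFG (A := L.ker)
      (LinearMap.ker_coFG_iff_hasFiniteRange.2 (hN.comp_right _)) fun x hx => ?_
    have hx' : N (W (x.fst - B (R x.snd))) = 0 := hx
    rw [map_sub, map_sub, sub_eq_zero] at hx'
    apply (WithLp.prodContinuousLinearEquiv 2 ℂ X Y).injective
    ext1 <;> simp [V, blockOp_apply, hA, hx', hDR, hUW'] <;> abel

end blockOp

/-! ### The function `Φ` below `ω₀ + γ` -/

section Phi

variable {d : ℕ} {ω : Rd d → ℝ} {lam : Rd d → ℂ} {γ α : ℝ}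

theorem omega0_le (hb' : BddBelow (range ω)) (k : Rd d) : omega0 ω ≤ ω k := ciInf_le hb' k

theorem le_omega1 (hb : BddAbove (range ω)) (k : Rd d) : ω k ≤ omega1 ω := le_ciSup hb k

theorem omega0_lt_omega1 (hb' : BddBelow (range ω)) (hb : BddAbove (range ω))
    (hnc : ∃ k q, ω k ≠ ω q) : omega0 ω < omega1 ω := by
  obtain ⟨k, q, hkq⟩ := hnc
  rcases lt_or_gt_of_ne hkq with h | h
  · exact (omega0_le hb' k).trans_lt (h.trans_le (le_omega1 hb q))
  · exact (omega0_le hb' q).trans_lt (h.trans_le (le_omega1 hb k))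

theorem integrable_norm_sq (hl : MemLp lam 2 volume) : Integrable (fun q => ‖lam q‖ ^ 2) volume :=
  hl.integrable_norm_pow (by norm_num)

theorem integrable_Phi (hb' : BddBelow (range ω)) (hc : Continuous ω) (hl : MemLp lam 2 volume)
    {z : ℝ} (hz : z < omega0 ω + γ) :
    Integrable (fun q => ‖lam q‖ ^ 2 / (ω q + γ - z)) volume := by
  refine Integrable.mono' ((integrable_norm_sq hl).div_const (omega0 ω + γ - z)) ?_ ?_
  · exact ((hl.1.norm.pow 2).aemeasurable.div
      (by fun_prop : Measurable _).aemeasurable).aestronglyMeasurable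
  · refine Filter.Eventually.of_forall fun q => ?_
    have h1 := omega0_le hb' q
    rw [Real.norm_eq_abs, abs_of_nonneg (div_nonneg (by positivity) (by linarith))]
    gcongr

theorem Phi_add_le (hb' : BddBelow (range ω)) (hc : Continuous ω) (hl : MemLp lam 2 volume)
    {z z' : ℝ} (hzz : z ≤ z') (hz : z' < omega0 ω + γ) :
    Phi ω lam γ α z' + (z' - z) ≤ Phi ω lam γ α z := by
  have : ∫ q, ‖lam q‖ ^ 2 / (ω q + γ - z) ≤ ∫ q, ‖lam q‖ ^ 2 / (ω q + γ - z') := by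
    refine integral_mono (integrable_Phi hb' hc hl (by linarith)) (integrable_Phi hb' hc hl hz)
      fun q => ?_
    have h1 := omega0_le hb' q
    simp only
    gcongr
    linarith
  have := mul_le_mul_of_nonneg_left this (sq_nonneg α)
  unfold Phi
  linarith

theorem Phi_continuousOn (hb' : BddBelow (range ω)) (hc : Continuous ω) (hl : MemLp lam 2 volume) :
    ContinuousOn (Phi ω lam γ α) (Iio (omega0 ω + γ)) := by
  intro z₀ hz₀
  apply ContinuousAt.continuousWithinAt
  rw [mem_Iio] at hz₀
  obtain ⟨z₁, h01, h1⟩ := exists_between hz₀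
  have hint : ContinuousAt (fun z => ∫ q, ‖lam q‖ ^ 2 / (ω q + γ - z)) z₀ := by
    refine continuousAt_of_dominated (bound := fun q => ‖lam q‖ ^ 2 / (omega0 ω + γ - z₁)) ?_ ?_
      ((integrable_norm_sq hl).div_const _) ?_
    · exact Filter.Eventually.of_forall fun z =>
        ((hl.1.norm.pow 2).aemeasurable.div
          (by fun_prop : Measurable _).aemeasurable).aestronglyMeasurable
    · filter_upwards [Iio_mem_nhds h01] with z hz
      refine Filter.Eventually.of_forall fun q => ?_
      have h2 := omega0_le hb' q
      rw [mem_Iio] at hz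
      rw [Real.norm_eq_abs, abs_of_nonneg (div_nonneg (by positivity) (by linarith))]
      gcongr
    · refine Filter.Eventually.of_forall fun q => ?_
      have h2 := omega0_le hb' q
      exact ContinuousAt.div (by fun_prop) (by fun_prop) (by linarith)
  unfold Phi
  fun_prop

/-- `Φ` is positive near `-∞`. -/
theorem exists_Phi_pos (hb' : BddBelow (range ω)) (hc : Continuous ω) (hl : MemLp lam 2 volume)
    (z₀ : ℝ) : ∃ z ≤ z₀, 0 < Phi ω lam γ α z := by
  set M := α ^ 2 * ∫ q, ‖lam q‖ ^ 2 with hM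
  refine ⟨min z₀ (min (omega0 ω + γ - 1) (-γ - M - 1)), min_le_left _ _, ?_⟩
  set z := min z₀ (min (omega0 ω + γ - 1) (-γ - M - 1)) with hz
  have hz1 : z ≤ omega0 ω + γ - 1 := (min_le_right _ _).trans (min_le_left _ _)
  have hz2 : z ≤ -γ - M - 1 := (min_le_right _ _).trans (min_le_right _ _)
  have : ∫ q, ‖lam q‖ ^ 2 / (ω q + γ - z) ≤ ∫ q, ‖lam q‖ ^ 2 := by
    refine integral_mono (integrable_Phi hb' hc hl (by linarith)) (integrable_norm_sq hl)
      fun q => ?_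
    have h1 := omega0_le hb' q
    exact div_le_self (by positivity) (by linarith)
  have := mul_le_mul_of_nonneg_left this (sq_nonneg α)
  unfold Phi
  linarith

/-- A point where `Φ ≤ 0` has a zero of `Φ` to its left. -/
theorem exists_zero_le (hb' : BddBelow (range ω)) (hc : Continuous ω) (hl : MemLp lam 2 volume)
    {z₀ : ℝ} (hz₀ : z₀ < omega0 ω + γ) (h : Phi ω lam γ α z₀ ≤ 0) :
    ∃ E ≤ z₀, Phi ω lam γ α E = 0 := by
  obtain ⟨z, hz, hpos⟩ := exists_Phi_pos (γ := γ) (α := α) hb' hc hl z₀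
  obtain ⟨E, hE, hE0⟩ := intermediate_value_Icc' hz ((Phi_continuousOn hb' hc hl).mono
    fun x hx => hx.2.trans_lt hz₀) (⟨h, hpos.le⟩ : (0 : ℝ) ∈ Icc _ _)
  exact ⟨E, hE.2, hE0⟩

theorem isLowerZero_of_zero (hb' : BddBelow (range ω)) (hc : Continuous ω)
    (hl : MemLp lam 2 volume) {E : ℝ} (hE : E < omega0 ω + γ) (h : Phi ω lam γ α E = 0) :
    IsLowerZero ω lam γ α E := by
  refine ⟨hE, h, fun z hz hz0 => ?_⟩
  rcases le_total z E with hle | hle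
  · have := Phi_add_le (γ := γ) (α := α) hb' hc hl hle hE
    linarith
  · have := Phi_add_le (γ := γ) (α := α) hb' hc hl hle hz
    linarith

/-- `Φ` is bounded away from zero on compact intervals without zeros. -/
theorem exists_le_abs_Phi (hb' : BddBelow (range ω)) (hc : Continuous ω) (hl : MemLp lam 2 volume)
    {a b : ℝ} (hb : b < omega0 ω + γ) (h : ∀ z ∈ Icc a b, Phi ω lam γ α z ≠ 0) :
    ∃ c > 0, ∀ z ∈ Icc a b, c ≤ |Phi ω lam γ α z| := by
  have hK : ContinuousOn (fun z => |Phi ω lam γ α z|) (Icc a b) :=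
    ((Phi_continuousOn hb' hc hl).mono fun x hx => hx.2.trans_lt hb).abs
  rcases (Icc a b).eq_empty_or_nonempty with he | hne
  · exact ⟨1, one_pos, by simp [he]⟩
  · obtain ⟨x, hx, hmin⟩ := isCompact_Icc.exists_isMinOn hne hK
    exact ⟨_, abs_pos.2 (h x hx), fun z hz => hmin hz⟩

end Phi

/-! ### Critical couplings -/

section weighted

variable {d : ℕ} {ω : Rd d → ℝ} {lam : Rd d → ℂ} {γ α : ℝ}

theorem enorm_sq_div_ofReal (c : ℂ) {t : ℝ} (ht : 0 < t) :
    ‖c‖ₑ ^ 2 / ENNReal.ofReal t = ENNReal.ofReal (‖c‖ ^ 2 / t) := by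
  rw [ENNReal.ofReal_div_of_pos ht, ENNReal.ofReal_pow (norm_nonneg _), ofReal_norm]

theorem weightedSq_pos (hl : MemLp lam 2 volume) (hl0 : ¬ lam =ᵐ[volume] 0) {w : Rd d → ℝ}
    (hw : Continuous w) : 0 < weightedSq lam w := by
  rw [pos_iff_ne_zero]
  intro h
  apply hl0
  have hm : AEMeasurable (fun q => ‖lam q‖ₑ ^ 2 / ENNReal.ofReal (w q)) volume :=
    (hl.1.enorm.pow_const 2).div (by fun_prop : Measurable _).aemeasurable
  rw [weightedSq, lintegral_eq_zero_iff' hm] at h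
  filter_upwards [h] with q hq
  have := ENNReal.div_eq_zero_iff.1 hq
  simpa using this

theorem weightedSq_eq_ofReal_integral {w : Rd d → ℝ} (hw : ∀ q, 0 < w q)
    (hi : Integrable (fun q => ‖lam q‖ ^ 2 / w q) volume) :
    weightedSq lam w = ENNReal.ofReal (∫ q, ‖lam q‖ ^ 2 / w q) := by
  rw [weightedSq, ofReal_integral_eq_lintegral_ofReal hi
    (Filter.Eventually.of_forall fun q => div_nonneg (by positivity) (hw q).le)]
  exact lintegral_congr fun q => enorm_sq_div_ofReal _ (hw q)

/-- The condition `α ≤ √s / ‖λ/√w‖` without square roots. -/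
theorem le_sqrt_div_weightedNorm (hl : MemLp lam 2 volume) (hl0 : ¬ lam =ᵐ[volume] 0)
    (hα : 0 < α) {w : Rd d → ℝ} (hw : Continuous w) (hfin : weightedSq lam w < ∞) {s : ℝ}
    (hs : 0 ≤ s) :
    α ≤ √s / weightedNorm lam w ↔ α ^ 2 * (weightedSq lam w).toReal ≤ s := by
  have hN : 0 < (weightedSq lam w).toReal :=
    ENNReal.toReal_pos (weightedSq_pos hl hl0 hw).ne' hfin.ne
  rw [weightedNorm, le_div_iff₀ (Real.sqrt_pos.2 hN), Real.le_sqrt (by positivity) hs, mul_pow,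
    Real.sq_sqrt hN.le]

/-- As `z ↑ ω₀ + γ`, `Φ(z)` decreases to `-2γ - ω₀ - α² ‖λ/√(ω - ω₀)‖²` (which is `-∞` in the
singular case), so `Φ` has no zero below `ω₀ + γ` exactly if this limit is nonnegative. -/
theorem lowAbsent_iff (hb' : BddBelow (range ω)) (hc : Continuous ω) (hl : MemLp lam 2 volume)
    (hl0 : ¬ lam =ᵐ[volume] 0) (hα : 0 < α) :
    LowAbsent ω lam γ α ↔ ∀ z < omega0 ω + γ, 0 < Phi ω lam γ α z := by
  have hw : Continuous fun q => ω q - omega0 ω := by fun_prop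
  have key : ∀ z < omega0 ω + γ, weightedSq lam (fun q => ω q + γ - z) =
      ENNReal.ofReal (∫ q, ‖lam q‖ ^ 2 / (ω q + γ - z)) := fun z hz =>
    weightedSq_eq_ofReal_integral (fun q => by linarith [omega0_le hb' q])
      (integrable_Phi hb' hc hl hz)
  have hnn : ∀ z < omega0 ω + γ, 0 ≤ ∫ q, ‖lam q‖ ^ 2 / (ω q + γ - z) := fun z hz =>
    integral_nonneg fun q => div_nonneg (by positivity) (by linarith [omega0_le hb' q])
  constructor
  · rintro ⟨hreg, hγ, hle⟩ z hz
    rw [alpha1, le_sqrt_div_weightedNorm hl hl0 hα hw hreg (by linarith)] at hle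
    have h1 : ∫ q, ‖lam q‖ ^ 2 / (ω q + γ - z) ≤
        (weightedSq lam fun q => ω q - omega0 ω).toReal := by
      rw [← ENNReal.ofReal_le_iff_le_toReal hreg.ne, ← key z hz]
      refine lintegral_mono fun q => ?_
      gcongr
      linarith
    have := mul_le_mul_of_nonneg_left h1 (sq_nonneg α)
    unfold Phi
    linarith
  · intro h
    -- Fatou's lemma along `z = ω₀ + γ - 1 / (n + 1)`
    have hbound : ∀ z < omega0 ω + γ, weightedSq lam (fun q => ω q + γ - z) ≤
        ENNReal.ofReal ((-γ - z) / α ^ 2) := by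
      intro z hz
      rw [key z hz]
      gcongr
      rw [le_div_iff₀ (by positivity)]
      have := h z hz
      unfold Phi at this
      linarith
    have hz : ∀ n : ℕ, omega0 ω + γ - 1 / ((n : ℝ) + 1) < omega0 ω + γ := fun n => by
      have : (0 : ℝ) < 1 / ((n : ℝ) + 1) := by positivity
      linarith
    have hlim : Filter.Tendsto (fun n : ℕ => omega0 ω + γ - 1 / ((n : ℝ) + 1)) Filter.atTop
        (nhds (omega0 ω + γ)) := by
      simpa using (tendsto_const_nhds (x := omega0 ω + γ)).sub
        tendsto_one_div_add_atTop_nhds_zero_nat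
    have hs : 0 ≤ -2 * γ - omega0 ω := by
      have h0 : ∀ z < omega0 ω + γ, 0 ≤ -γ - z := fun z hz => by
        have h1 := h z hz
        have h2 := mul_nonneg (sq_nonneg α) (hnn z hz)
        unfold Phi at h1
        linarith
      have := le_of_tendsto_of_tendsto' tendsto_const_nhds
        ((tendsto_const_nhds (x := -γ)).sub hlim) fun n => h0 _ (hz n)
      linarith
    have hfatou : weightedSq lam (fun q => ω q - omega0 ω) ≤
        ENNReal.ofReal ((-2 * γ - omega0 ω) / α ^ 2) := by
      have hpt : ∀ q, ‖lam q‖ₑ ^ 2 / ENNReal.ofReal (ω q - omega0 ω) = Filter.liminf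
          (fun n : ℕ => ‖lam q‖ₑ ^ 2 /
            ENNReal.ofReal (ω q + γ - (omega0 ω + γ - 1 / ((n : ℝ) + 1)))) Filter.atTop := by
        intro q
        refine (Filter.Tendsto.liminf_eq ?_).symm
        by_cases hq : lam q = 0
        · simp [hq]
        · have := (tendsto_const_nhds (x := ω q + γ)).sub hlim
          rw [show ω q + γ - (omega0 ω + γ) = ω q - omega0 ω by ring] at this
          refine ENNReal.Tendsto.div tendsto_const_nhds (Or.inl (by simpa using hq))
            (ENNReal.tendsto_ofReal this) (Or.inl (by finiteness))
      calc weightedSq lam (fun q => ω q - omega0 ω)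
          = ∫⁻ q, Filter.liminf (fun n : ℕ => ‖lam q‖ₑ ^ 2 /
            ENNReal.ofReal (ω q + γ - (omega0 ω + γ - 1 / ((n : ℝ) + 1)))) Filter.atTop :=
            lintegral_congr hpt
        _ ≤ Filter.liminf (fun n : ℕ => weightedSq lam
              (fun q => ω q + γ - (omega0 ω + γ - 1 / ((n : ℝ) + 1)))) Filter.atTop :=
            lintegral_liminf_le' fun n => (hl.1.enorm.pow_const 2).div
              (by fun_prop : Measurable _).aemeasurable
        _ ≤ Filter.liminf (fun n : ℕ => ENNReal.ofReal
              ((-γ - (omega0 ω + γ - 1 / ((n : ℝ) + 1))) / α ^ 2)) Filter.atTop :=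
            Filter.liminf_le_liminf (Filter.Eventually.of_forall fun n => hbound _ (hz n))
        _ = _ := by
            refine Filter.Tendsto.liminf_eq (ENNReal.tendsto_ofReal ?_)
            have := ((tendsto_const_nhds (x := -γ)).sub hlim).div_const (α ^ 2)
            rwa [show -γ - (omega0 ω + γ) = -2 * γ - omega0 ω by ring] at this
    have hreg : RegularLow ω lam := hfatou.trans_lt ENNReal.ofReal_lt_top
    refine ⟨hreg, by linarith, ?_⟩
    rw [alpha1, le_sqrt_div_weightedNorm hl hl0 hα hw hreg hs]
    have := ENNReal.toReal_le_of_le_ofReal (by positivity) hfatou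
    rw [le_div_iff₀ (by positivity)] at this
    linarith

/-- The sign of `Φ` at `2ω₀ - ω₁ + γ` decides whether `ω₁ + E < 2ω₀ + γ`. -/
theorem Phi_nonneg_iff (hb' : BddBelow (range ω)) (hc : Continuous ω) (hl : MemLp lam 2 volume)
    (hl0 : ¬ lam =ᵐ[volume] 0) (hα : 0 < α) (hlt : omega0 ω < omega1 ω) :
    0 ≤ Phi ω lam γ α (2 * omega0 ω - omega1 ω + γ) ↔
      γ ≤ omega1 ω / 2 - omega0 ω ∧ α ≤ alpha2 ω lam γ := by
  have hz : 2 * omega0 ω - omega1 ω + γ < omega0 ω + γ := by linarith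
  have hwe : (fun q => omega1 ω - 2 * omega0 ω + ω q) =
      fun q => ω q + γ - (2 * omega0 ω - omega1 ω + γ) := by
    funext q
    ring
  have hpos : ∀ q, 0 < ω q + γ - (2 * omega0 ω - omega1 ω + γ) := fun q => by
    linarith [omega0_le hb' q]
  have hint : (0 : ℝ) ≤ ∫ q, ‖lam q‖ ^ 2 / (ω q + γ - (2 * omega0 ω - omega1 ω + γ)) :=
    integral_nonneg fun q => div_nonneg (by positivity) (hpos q).le
  have hsq := weightedSq_eq_ofReal_integral hpos (integrable_Phi hb' hc hl hz)
  have hfin : weightedSq lam (fun q => ω q + γ - (2 * omega0 ω - omega1 ω + γ)) < ∞ := by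
    rw [hsq]
    exact ENNReal.ofReal_lt_top
  have hw : Continuous fun q => ω q + γ - (2 * omega0 ω - omega1 ω + γ) := by fun_prop
  have hmul := mul_nonneg (sq_nonneg α) hint
  have hiff : ∀ s, 0 ≤ s → (α ≤ √s / weightedNorm lam
      (fun q => ω q + γ - (2 * omega0 ω - omega1 ω + γ)) ↔
      α ^ 2 * ∫ q, ‖lam q‖ ^ 2 / (ω q + γ - (2 * omega0 ω - omega1 ω + γ)) ≤ s) := fun s hs => by
    rw [le_sqrt_div_weightedNorm hl hl0 hα hw hfin hs, hsq, ENNReal.toReal_ofReal hint]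
  unfold Phi alpha2
  rw [hwe]
  constructor
  · intro h
    refine ⟨by linarith, (hiff _ (by linarith)).2 (by linarith)⟩
  · rintro ⟨h1, h2⟩
    have := (hiff _ (by linarith)).1 h2
    linarith

theorem exists_isLowerZero_of_attached (hb' : BddBelow (range ω)) (hc : Continuous ω)
    (hl : MemLp lam 2 volume) (hl0 : ¬ lam =ᵐ[volume] 0) (hα : 0 < α)
    (hlt : omega0 ω < omega1 ω) (h : LowAttached ω lam γ α) :
    ∃ E, IsLowerZero ω lam γ α E ∧ 2 * omega0 ω + γ ≤ omega1 ω + E := by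
  obtain ⟨h1, h2⟩ := h
  rw [lowAbsent_iff hb' hc hl hl0 hα] at h1
  push Not at h1
  obtain ⟨z, hz, hz0⟩ := h1
  obtain ⟨E, hEz, hE⟩ := exists_zero_le hb' hc hl hz hz0
  refine ⟨E, isLowerZero_of_zero hb' hc hl (hEz.trans_lt hz) hE, ?_⟩
  rw [← Phi_nonneg_iff hb' hc hl hl0 hα hlt] at h2
  by_contra! hcon
  have := Phi_add_le (γ := γ) (α := α) hb' hc hl
    (show E ≤ 2 * omega0 ω - omega1 ω + γ by linarith) (by linarith)
  linarith

theorem exists_isLowerZero_of_detached (hb' : BddBelow (range ω)) (hc : Continuous ω)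
    (hl : MemLp lam 2 volume) (hl0 : ¬ lam =ᵐ[volume] 0) (hα : 0 < α)
    (hlt : omega0 ω < omega1 ω) (h : LowDetached ω lam γ α) :
    ∃ E, IsLowerZero ω lam γ α E ∧ omega1 ω + E < 2 * omega0 ω + γ := by
  have h1 : Phi ω lam γ α (2 * omega0 ω - omega1 ω + γ) < 0 := by
    rw [← not_le, Phi_nonneg_iff hb' hc hl hl0 hα hlt]
    rintro ⟨h2, h3⟩
    rcases h with h | h
    · linarith
    · linarith [h.2]
  obtain ⟨E, hEz, hE⟩ := exists_zero_le hb' hc hl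
    (show 2 * omega0 ω - omega1 ω + γ < omega0 ω + γ by linarith) h1.le
  refine ⟨E, isLowerZero_of_zero hb' hc hl (by linarith) hE, ?_⟩
  rcases hEz.lt_or_eq with h2 | h2
  · linarith
  · rw [h2] at hE
    linarith

end weighted

/-! ### Reflection of the dispersion relation -/

section reflection

variable {d : ℕ} {ω : Rd d → ℝ} {lam : Rd d → ℂ} {γ α : ℝ}

/-- The reflected function `ω₀ + ω₁ - ω`, which has the same infimum and supremum as `ω`. -/
noncomputable def reflect (ω : Rd d → ℝ) : Rd d → ℝ := fun k => omega0 ω + omega1 ω - ω k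

/-- The parameter `γ` belonging to the reflected function. -/
noncomputable def reflectGamma (ω : Rd d → ℝ) (γ : ℝ) : ℝ := -γ - (omega0 ω + omega1 ω) / 2

theorem omega0_reflect (hb : BddAbove (range ω)) : omega0 (reflect ω) = omega0 ω := by
  have h : IsGLB (range (reflect ω)) (omega0 ω) := by
    constructor
    · rintro _ ⟨k, rfl⟩
      have := le_omega1 hb k
      simp only [reflect]
      linarith
    · intro m hm
      have : omega1 ω ≤ omega0 ω + omega1 ω - m := ciSup_le fun k => by
        have := hm ⟨k, rfl⟩
        simp only [reflect] at this
        linarith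
      linarith
  exact h.ciInf_eq

theorem omega1_reflect (hb' : BddBelow (range ω)) : omega1 (reflect ω) = omega1 ω := by
  have h : IsLUB (range (reflect ω)) (omega1 ω) := by
    constructor
    · rintro _ ⟨k, rfl⟩
      have := omega0_le hb' k
      simp only [reflect]
      linarith
    · intro m hm
      have : omega0 ω + omega1 ω - m ≤ omega0 ω := le_ciInf fun k => by
        have := hm ⟨k, rfl⟩
        simp only [reflect] at this
        linarith
      linarith
  exact h.ciSup_eq

theorem bddBelow_reflect (hb : BddAbove (range ω)) : BddBelow (range (reflect ω)) := by
  refine ⟨omega0 ω, ?_⟩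
  rintro _ ⟨k, rfl⟩
  have := le_omega1 hb k
  simp only [reflect]
  linarith

theorem continuous_reflect (hc : Continuous ω) : Continuous (reflect ω) := by
  unfold reflect
  fun_prop

/-- Reflection turns `Φ` above `ω₁ + γ` into `-Φ` below `ω₀ + γ`. -/
theorem Phi_reflect (z : ℝ) : Phi (reflect ω) lam (reflectGamma ω γ) α
    ((omega0 ω + omega1 ω) / 2 - z) = -Phi ω lam γ α z := by
  have h : ∀ q, ‖lam q‖ ^ 2 / (reflect ω q + reflectGamma ω γ - ((omega0 ω + omega1 ω) / 2 - z)) =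
      -(‖lam q‖ ^ 2 / (ω q + γ - z)) := fun q => by
    rw [← div_neg]
    congr 1
    simp only [reflect, reflectGamma]
    ring
  unfold Phi
  rw [integral_congr_ae (Filter.Eventually.of_forall h), integral_neg, reflectGamma]
  ring

theorem isUpperZero_of_reflect (hb : BddAbove (range ω)) {E : ℝ}
    (h : IsLowerZero (reflect ω) lam (reflectGamma ω γ) α E) :
    IsUpperZero ω lam γ α ((omega0 ω + omega1 ω) / 2 - E) := by
  obtain ⟨h1, h2, h3⟩ := h
  rw [omega0_reflect hb] at h1 h3
  unfold reflectGamma at h1 h3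
  refine ⟨by linarith, ?_, fun z hz hz0 => ?_⟩
  · have := Phi_reflect (ω := ω) (lam := lam) (γ := γ) (α := α) ((omega0 ω + omega1 ω) / 2 - E)
    rw [sub_sub_cancel, h2] at this
    linarith
  · have h4 := h3 ((omega0 ω + omega1 ω) / 2 - z) (by linarith)
    rw [← reflectGamma, Phi_reflect, hz0, neg_zero] at h4
    have := h4 rfl
    linarith

theorem lowAbsent_reflect (hb : BddAbove (range ω)) :
    LowAbsent (reflect ω) lam (reflectGamma ω γ) α ↔ HighAbsent ω lam γ α := by
  have h1 : (fun q => reflect ω q - omega0 ω) = fun q => omega1 ω - ω q := by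
    funext q
    simp only [reflect]
    ring
  have h2 : -2 * reflectGamma ω γ - omega0 ω = omega1 ω + 2 * γ := by
    simp only [reflectGamma]
    ring
  have h3 : reflectGamma ω γ ≤ -omega0 ω / 2 ↔ -omega1 ω / 2 ≤ γ := by
    simp only [reflectGamma]
    constructor <;> intro h <;> linarith
  simp only [LowAbsent, HighAbsent, RegularLow, RegularHigh, alpha1, alpha3, omega0_reflect hb, h1,
    h2, h3]

theorem alpha2_reflect (hb' : BddBelow (range ω)) (hb : BddAbove (range ω)) :
    alpha2 (reflect ω) lam (reflectGamma ω γ) = alpha4 ω lam γ := by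
  have h1 : (fun q => omega1 ω - 2 * omega0 ω + reflect ω q) =
      fun q => 2 * omega1 ω - omega0 ω - ω q := by
    funext q
    simp only [reflect]
    ring
  have h2 : omega1 ω - 2 * omega0 ω - 2 * reflectGamma ω γ = 2 * omega1 ω - omega0 ω + 2 * γ := by
    simp only [reflectGamma]
    ring
  simp only [alpha2, alpha4, omega0_reflect hb, omega1_reflect hb', h1, h2]

theorem reflectGamma_le_iff :
    reflectGamma ω γ ≤ omega1 ω / 2 - omega0 ω ↔ omega0 ω / 2 - omega1 ω ≤ γ := by
  simp only [reflectGamma]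
  constructor <;> intro h <;> linarith

theorem lowAttached_reflect (hb' : BddBelow (range ω)) (hb : BddAbove (range ω)) :
    LowAttached (reflect ω) lam (reflectGamma ω γ) α ↔ HighAttached ω lam γ α := by
  simp only [LowAttached, HighAttached, lowAbsent_reflect hb, alpha2_reflect hb' hb,
    omega0_reflect hb, omega1_reflect hb', reflectGamma_le_iff]

theorem lowDetached_reflect (hb' : BddBelow (range ω)) (hb : BddAbove (range ω)) :
    LowDetached (reflect ω) lam (reflectGamma ω γ) α ↔ HighDetached ω lam γ α := by
  simp only [LowDetached, HighDetached, alpha2_reflect hb' hb, omega0_reflect hb,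
    omega1_reflect hb', reflectGamma_le_iff, ← not_le]

theorem Phi_neg_of_highAbsent (hb : BddAbove (range ω)) (hc : Continuous ω)
    (hl : MemLp lam 2 volume) (hl0 : ¬ lam =ᵐ[volume] 0) (hα : 0 < α)
    (h : HighAbsent ω lam γ α) {z : ℝ} (hz : omega1 ω + γ < z) : Phi ω lam γ α z < 0 := by
  rw [← lowAbsent_reflect hb, lowAbsent_iff (bddBelow_reflect hb) (continuous_reflect hc) hl hl0 hα,
    omega0_reflect hb] at h
  have := h ((omega0 ω + omega1 ω) / 2 - z) (by unfold reflectGamma; linarith)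
  rw [Phi_reflect] at this
  linarith

theorem exists_isUpperZero_of_attached (hb' : BddBelow (range ω)) (hb : BddAbove (range ω))
    (hc : Continuous ω) (hl : MemLp lam 2 volume) (hl0 : ¬ lam =ᵐ[volume] 0) (hα : 0 < α)
    (hlt : omega0 ω < omega1 ω) (h : HighAttached ω lam γ α) :
    ∃ F, IsUpperZero ω lam γ α F ∧ omega0 ω + F ≤ 2 * omega1 ω + γ := by
  obtain ⟨E, hE, hle⟩ := exists_isLowerZero_of_attached (bddBelow_reflect hb)
    (continuous_reflect hc) hl hl0 hα (by rwa [omega0_reflect hb, omega1_reflect hb'])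
    ((lowAttached_reflect hb' hb).2 h)
  refine ⟨_, isUpperZero_of_reflect hb hE, ?_⟩
  rw [omega0_reflect hb, omega1_reflect hb', reflectGamma] at hle
  linarith

theorem exists_isUpperZero_of_detached (hb' : BddBelow (range ω)) (hb : BddAbove (range ω))
    (hc : Continuous ω) (hl : MemLp lam 2 volume) (hl0 : ¬ lam =ᵐ[volume] 0) (hα : 0 < α)
    (hlt : omega0 ω < omega1 ω) (h : HighDetached ω lam γ α) :
    ∃ F, IsUpperZero ω lam γ α F ∧ 2 * omega1 ω + γ < omega0 ω + F := by
  obtain ⟨E, hE, hle⟩ := exists_isLowerZero_of_detached (bddBelow_reflect hb)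
    (continuous_reflect hc) hl hl0 hα (by rwa [omega0_reflect hb, omega1_reflect hb'])
    ((lowDetached_reflect hb' hb).2 h)
  refine ⟨_, isUpperZero_of_reflect hb hE, ?_⟩
  rw [omega0_reflect hb, omega1_reflect hb', reflectGamma] at hle
  linarith

theorem exists_le_abs_Phi_upper (hb : BddAbove (range ω)) (hc : Continuous ω)
    (hl : MemLp lam 2 volume) {a b : ℝ} (ha : omega1 ω + γ < a)
    (h : ∀ z ∈ Icc a b, Phi ω lam γ α z ≠ 0) : ∃ c > 0, ∀ z ∈ Icc a b, c ≤ |Phi ω lam γ α z| := by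
  obtain ⟨c, hc0, hcz⟩ := exists_le_abs_Phi (ω := reflect ω) (lam := lam) (γ := reflectGamma ω γ)
    (α := α) (a := (omega0 ω + omega1 ω) / 2 - b) (b := (omega0 ω + omega1 ω) / 2 - a)
    (bddBelow_reflect hb) (continuous_reflect hc) hl
    (by rw [omega0_reflect hb, reflectGamma]; linarith) (fun z hz h0 => by
      have h1 := Phi_reflect (ω := ω) (lam := lam) (γ := γ) (α := α)
        ((omega0 ω + omega1 ω) / 2 - z)
      rw [sub_sub_cancel, h0] at h1
      exact h ((omega0 ω + omega1 ω) / 2 - z) ⟨by linarith [hz.2], by linarith [hz.1]⟩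
        (by linarith))
  refine ⟨c, hc0, fun z hz => ?_⟩
  have := hcz ((omega0 ω + omega1 ω) / 2 - z) ⟨by linarith [hz.2], by linarith [hz.1]⟩
  rwa [Phi_reflect, abs_neg] at this

end reflection

/-! ### Formulas for the operators -/

section formulas

variable {d : ℕ} {ω : Rd d → ℝ} {lam : Rd d → ℂ}

theorem L2s_ext {g g' : L2s d} (h : (g : Lp ℂ 2 (halfVol d)) =ᵐ[halfVol d] g') : g = g' :=
  Subtype.ext (Lp.ext h)

theorem coeFn_L2s_add (g g' : L2s d) :
    ((g + g' : L2s d) : Lp ℂ 2 (halfVol d)) =ᵐ[halfVol d] fun p =>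
      (g : Lp ℂ 2 (halfVol d)) p + (g' : Lp ℂ 2 (halfVol d)) p :=
  Lp.coeFn_add _ _

theorem opA_coeFn (h0 : ∀ k, 0 ≤ ω k) (hc : Continuous ω) (hb : BddAbove (range ω)) (γ : ℝ)
    (f : L2 d) : opA h0 hc hb γ f =ᵐ[volume] fnA ω γ f := l2Op_coeFn _ f

theorem opB_coeFn (hl : MemLp lam 2 volume) (α : ℝ) (g : L2s d) :
    opB hl α g =ᵐ[volume] fnB lam α (g : Lp ℂ 2 (halfVol d)) :=
  l2Op_coeFn (isL2Bounded_fnB hl α) _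

theorem opC_coeFn (hl : MemLp lam 2 volume) (α : ℝ) (f : L2 d) :
    (opC hl α f : Lp ℂ 2 (halfVol d)) =ᵐ[halfVol d] fnC lam α f :=
  l2Op_coeFn (isL2Bounded_fnC hl α) _

theorem opD_coeFn (h0 : ∀ k, 0 ≤ ω k) (hc : Continuous ω) (hb : BddAbove (range ω)) (γ : ℝ)
    (g : L2s d) : (opD h0 hc hb γ g : Lp ℂ 2 (halfVol d)) =ᵐ[halfVol d]
      fnD ω γ (g : Lp ℂ 2 (halfVol d)) := l2Op_coeFn (isL2Bounded_fnD h0 hc hb γ) _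

theorem opMatrix_eq_blockOp (h0 : ∀ k, 0 ≤ ω k) (hc : Continuous ω) (hb : BddAbove (range ω))
    (hl : MemLp lam 2 volume) (γ α : ℝ) : opMatrix h0 hc hb hl γ α =
      blockOp (opA h0 hc hb γ) (opB hl α) (opC hl α) (opD h0 hc hb γ) := rfl

/-- Multiplication by the bounded symmetric function `m` on `L²_s(ℝ^d × ℝ^d)`. -/
noncomputable def mulL2s (m : Rd d × Rd d → ℂ) (hm : AEStronglyMeasurable m (halfVol d))
    (hb : ∃ C : ℝ, ∀ p, ‖m p‖ ≤ C) (hs : ∀ p, m p.swap = m p) : L2s d →L[ℂ] L2s d :=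
  (l2Op (isL2Bounded_mul m hm hb)).restrict (by
    intro g hg
    have h : ∀ᵐ p ∂(volume : Measure (Rd d × Rd d)),
        l2Op (isL2Bounded_mul m hm hb) g p = m p * g p :=
      ae_halfVol.1 (l2Op_coeFn (isL2Bounded_mul m hm hb) g)
    have h' := (Measure.measurePreserving_swap (μ := (volume : Measure (Rd d)))
      (ν := volume)).quasiMeasurePreserving.ae h
    have hg' : ∀ᵐ p ∂(volume : Measure (Rd d × Rd d)), g p.swap = g p := hg
    change ∀ᵐ p ∂(volume : Measure (Rd d × Rd d)), _
    filter_upwards [h, h', hg'] with p hp hp' hgp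
    change l2Op (isL2Bounded_mul m hm hb) g p.swap = l2Op (isL2Bounded_mul m hm hb) g p
    rw [hp, hp', hgp, hs])

theorem mulL2s_coeFn {m : Rd d × Rd d → ℂ} (hm : AEStronglyMeasurable m (halfVol d))
    (hb : ∃ C : ℝ, ∀ p, ‖m p‖ ≤ C) (hs : ∀ p, m p.swap = m p) (g : L2s d) :
    (mulL2s m hm hb hs g : Lp ℂ 2 (halfVol d)) =ᵐ[halfVol d] fun p =>
      m p * (g : Lp ℂ 2 (halfVol d)) p := l2Op_coeFn (isL2Bounded_mul m hm hb) _

theorem opA_sub_coeFn (h0 : ∀ k, 0 ≤ ω k) (hc : Continuous ω) (hb : BddAbove (range ω)) (γ : ℝ)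
    (z : ℂ) (f : L2 d) : (opA h0 hc hb γ - z • ContinuousLinearMap.id ℂ (L2 d)) f =ᵐ[volume]
      fun k => (-γ + ω k - z) * f k := by
  have h1 : (opA h0 hc hb γ - z • ContinuousLinearMap.id ℂ (L2 d)) f =
    opA h0 hc hb γ f - z • f := rfl
  rw [h1]
  filter_upwards [Lp.coeFn_sub (opA h0 hc hb γ f) (z • f), Lp.coeFn_smul z f,
    opA_coeFn h0 hc hb γ f] with k h2 h3 h4
  rw [h2, Pi.sub_apply, h3, h4, fnA, Pi.smul_apply, smul_eq_mul]
  push_cast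
  ring

theorem opD_sub_coeFn (h0 : ∀ k, 0 ≤ ω k) (hc : Continuous ω) (hb : BddAbove (range ω)) (γ : ℝ)
    (z : ℂ) (g : L2s d) :
    ((opD h0 hc hb γ - z • ContinuousLinearMap.id ℂ (L2s d)) g : Lp ℂ 2 (halfVol d)) =ᵐ[halfVol d]
      fun p => (γ + ω p.1 + ω p.2 - z) * (g : Lp ℂ 2 (halfVol d)) p := by
  have h1 : ((opD h0 hc hb γ - z • ContinuousLinearMap.id ℂ (L2s d)) g : Lp ℂ 2 (halfVol d)) =
    (opD h0 hc hb γ g : Lp ℂ 2 (halfVol d)) - z • (g : Lp ℂ 2 (halfVol d)) := rfl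
  rw [h1]
  filter_upwards [Lp.coeFn_sub (opD h0 hc hb γ g : Lp ℂ 2 (halfVol d))
    (z • (g : Lp ℂ 2 (halfVol d))), Lp.coeFn_smul z (g : Lp ℂ 2 (halfVol d)),
    opD_coeFn h0 hc hb γ g] with k h2 h3 h4
  rw [h2, Pi.sub_apply, h3, h4, fnD, Pi.smul_apply, smul_eq_mul]
  push_cast
  ring

theorem norm_l2Op_le {X Y : Type*} [MeasurableSpace X] [MeasurableSpace Y] {μ : Measure X}
    {ν : Measure Y} {F : (X → ℂ) → (Y → ℂ)} (h : IsL2Bounded μ ν F) (C : ℝ≥0)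
    (hC : ∀ f : X → ℂ, MemLp f 2 μ → eLpNorm (F f) 2 ν ≤ C * eLpNorm f 2 μ) :
    ‖l2Op h‖ ≤ C := by
  refine ContinuousLinearMap.opNorm_le_bound _ C.2 fun f => ?_
  rw [Lp.norm_def, Lp.norm_def, eLpNorm_congr_ae (l2Op_coeFn h f)]
  have := ENNReal.toReal_mono (ENNReal.mul_ne_top ENNReal.coe_ne_top (Lp.memLp f).2.ne)
    (hC f (Lp.memLp f))
  simpa [ENNReal.toReal_mul] using this

/-- The functional `f ↦ ∫ g f` on `L²(ℝ^d)`. -/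
noncomputable def pairing {g : Rd d → ℂ} (hg : MemLp g 2 volume) : L2 d →L[ℂ] ℂ :=
  innerSL ℂ hg.star.toLp

theorem pairing_apply {g : Rd d → ℂ} (hg : MemLp g 2 volume) (f : L2 d) :
    pairing hg f = ∫ q, g q * f q := by
  rw [pairing, innerSL_apply_apply, L2.inner_def]
  refine integral_congr_ae ?_
  filter_upwards [hg.star.coeFn_toLp] with q hq
  rw [hq, RCLike.inner_apply]
  simp [mul_comm]

/-- An invertible multiplication operator on `L²(ℝ^d)`. -/
theorem isUnit_mul {m : Rd d → ℂ} (hm : AEStronglyMeasurable m volume)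
    (hb : ∃ C : ℝ, ∀ x, ‖m x‖ ≤ C) (hpos : ∃ c > 0, ∀ x, c ≤ ‖m x‖) :
    IsUnit (l2Op (isL2Bounded_mul m hm hb)) := by
  obtain ⟨c, hc, hcm⟩ := hpos
  have hm0 : ∀ x, m x ≠ 0 := fun x => norm_pos_iff.1 (hc.trans_le (hcm x))
  have hm' : AEStronglyMeasurable (fun x => (m x)⁻¹) volume :=
    hm.aemeasurable.inv.aestronglyMeasurable
  have hb' : ∃ C : ℝ, ∀ x, ‖(m x)⁻¹‖ ≤ C := ⟨c⁻¹, fun x => by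
    rw [norm_inv]
    exact inv_anti₀ hc (hcm x)⟩
  refine ⟨⟨l2Op (isL2Bounded_mul m hm hb), l2Op (isL2Bounded_mul _ hm' hb'), ?_, ?_⟩, rfl⟩
  · ext1 f
    apply Lp.ext
    filter_upwards [l2Op_coeFn (isL2Bounded_mul m hm hb) (l2Op (isL2Bounded_mul _ hm' hb') f),
      l2Op_coeFn (isL2Bounded_mul _ hm' hb') f] with x h1 h2
    rw [mul_apply_eq_comp, h1, h2, one_apply_eq_self,
      mul_inv_cancel_left₀ (hm0 x)]
  · ext1 f
    apply Lp.ext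
    filter_upwards [l2Op_coeFn (isL2Bounded_mul _ hm' hb') (l2Op (isL2Bounded_mul m hm hb) f),
      l2Op_coeFn (isL2Bounded_mul m hm hb) f] with x h1 h2
    rw [mul_apply_eq_comp, h1, h2, one_apply_eq_self,
      inv_mul_cancel_left₀ (hm0 x)]

end formulas

/-! ### Integral operators with kernel `conj λ(k) κ(k,q) λ(q)` -/

section kernel

variable {d : ℕ} {lam : Rd d → ℂ}

/-- The formula `f ↦ conj λ(k) ∫ κ(k,q) λ(q) f(q) dq`. -/
noncomputable def fnK (lam : Rd d → ℂ) (κ : Rd d → Rd d → ℂ) (f : Rd d → ℂ) : Rd d → ℂ :=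
  fun k => conj (lam k) * ∫ q, κ k q * (lam q * f q)

theorem integrable_kernel (hl : MemLp lam 2 volume) {κ : Rd d → ℂ} (hκ : Measurable κ)
    {C : ℝ} (hC : ∀ q, ‖κ q‖ ≤ C) {f : Rd d → ℂ} (hf : MemLp f 2 volume) :
    Integrable (fun q => κ q * (lam q * f q)) volume :=
  (hl.integrable_mul hf).bdd_mul hκ.aestronglyMeasurable (Filter.Eventually.of_forall hC)

theorem eLpNorm_fnK_le (hl : MemLp lam 2 volume) {κ : Rd d → Rd d → ℂ} {C : ℝ≥0}
    (hC : ∀ k q, ‖κ k q‖ ≤ C) {f : Rd d → ℂ} (hf : MemLp f 2 volume) :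
    eLpNorm (fnK lam κ f) 2 volume ≤
      (C * (eLpNorm lam 2 volume).toNNReal ^ 2 : ℝ≥0) * eLpNorm f 2 volume := by
  set a := (eLpNorm lam 2 volume).toNNReal with ha
  set b := (eLpNorm f 2 volume).toNNReal with hb
  have hae : (a : ℝ≥0∞) = eLpNorm lam 2 volume := ENNReal.coe_toNNReal hl.2.ne
  have hbe : (b : ℝ≥0∞) = eLpNorm f 2 volume := ENNReal.coe_toNNReal hf.2.ne
  have hint : ∀ k, ‖∫ q, κ k q * (lam q * f q)‖ₑ ≤ (C * (a * b) : ℝ≥0) := by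
    intro k
    refine (enorm_integral_le_lintegral_enorm _).trans ?_
    calc ∫⁻ q, ‖κ k q * (lam q * f q)‖ₑ ≤ ∫⁻ q, C * ‖lam q * f q‖ₑ := by
          refine lintegral_mono fun q => ?_
          simp only
          rw [enorm_mul]
          gcongr
          rw [enorm_le_coe]
          exact hC k q
      _ = C * ∫⁻ q, ‖lam q * f q‖ₑ := lintegral_const_mul' _ _ ENNReal.coe_ne_top
      _ ≤ C * (eLpNorm lam 2 volume * eLpNorm f 2 volume) := by
          gcongr
          rw [← eLpNorm_one_eq_lintegral_enorm]
          have h : eLpNorm (lam • f) 1 volume ≤ eLpNorm lam 2 volume * eLpNorm f 2 volume :=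
            eLpNorm_smul_le_mul_eLpNorm hf.1 hl.1
          exact h
      _ = _ := by
          rw [← hae, ← hbe]
          push_cast
          rfl
  have := eLpNorm_le_nnreal_smul_eLpNorm_of_ae_le_mul (μ := volume) (f := fnK lam κ f) (g := lam)
    (c := C * (a * b)) (Filter.Eventually.of_forall fun k => by
      simp only [fnK]
      rw [nnnorm_mul, mul_comm]
      have h1 : ‖conj (lam k)‖₊ = ‖lam k‖₊ := by simp
      rw [h1]
      gcongr
      exact enorm_le_coe.1 (hint k)) 2
  refine this.trans (le_of_eq ?_)
  rw [ENNReal.smul_def, smul_eq_mul, ← hae, ← hbe]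
  push_cast
  ring

theorem isL2Bounded_fnK (hl : MemLp lam 2 volume) {κ : Rd d → Rd d → ℂ}
    (hκ : Measurable (Function.uncurry κ)) {C : ℝ≥0} (hC : ∀ k q, ‖κ k q‖ ≤ C) :
    IsL2Bounded volume volume (fnK lam κ) where
  congr f g h := by
    filter_upwards with k
    simp only [fnK]
    congr 1
    apply integral_congr_ae
    filter_upwards [h] with q hq
    rw [hq]
  add f g hf hg := by
    filter_upwards with k
    simp only [fnK, Pi.add_apply, mul_add]
    rw [integral_add (integrable_kernel hl (hκ.of_uncurry_left) (hC k) hf)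
      (integrable_kernel hl (hκ.of_uncurry_left) (hC k) hg), mul_add]
  smul c f _ := by
    filter_upwards with k
    have h : ∀ q, κ k q * (lam q * (c * f q)) = c * (κ k q * (lam q * f q)) := fun q => by ring
    simp only [fnK, Pi.smul_apply, smul_eq_mul, h]
    rw [integral_const_mul]
    ring
  meas f hf := by
    have hl' : AEStronglyMeasurable (fun k => conj (lam k)) volume :=
      Complex.continuous_conj.comp_aestronglyMeasurable hl.1
    have h : AEStronglyMeasurable (fun p : Rd d × Rd d => κ p.1 p.2 * (lam p.2 * f p.2))
        ((volume : Measure (Rd d)).prod (volume : Measure (Rd d))) :=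
      hκ.aestronglyMeasurable.mul (hl.1.comp_snd.mul hf.1.comp_snd)
    exact hl'.mul h.integral_prod_right'
  bound := ⟨_, fun _ hf => eLpNorm_fnK_le hl hC hf⟩

/-- If the kernel `κ(k,q)` depends on `k` only through finitely many values of `i(k)`, then the
integral operator has finite rank. -/
theorem hasFiniteRange_fnK (hl : MemLp lam 2 volume) {κ : Rd d → Rd d → ℂ}
    (hκ : Measurable (Function.uncurry κ)) {C : ℝ≥0} (hC : ∀ k q, ‖κ k q‖ ≤ C)
    {ι : Type*} (i : Rd d → ι) (hi : (range i).Finite) (hκi : ∀ k k', i k = i k' → κ k = κ k') :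
    (l2Op (isL2Bounded_fnK hl hκ hC)).toLinearMap.HasFiniteRange := by
  have hm : ∀ k, MemLp (fun q => κ k q * lam q) 2 volume := fun k =>
    MemLp.of_le_mul hl ((hκ.of_uncurry_left).aestronglyMeasurable.mul hl.1)
      (Filter.Eventually.of_forall fun q => by
        rw [norm_mul]
        exact mul_le_mul_of_nonneg_right (hC k q) (norm_nonneg _))
  have : Finite (range i) := hi
  let rep : range i → Rd d := fun j => j.2.choose
  have hrep : ∀ j, i (rep j) = j := fun j => j.2.choose_spec
  let L : L2 d →ₗ[ℂ] (range i → ℂ) := LinearMap.pi fun j => (pairing (hm (rep j))).toLinearMap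
  rw [← LinearMap.ker_coFG_iff_hasFiniteRange]
  refine Submodule.CoFG.of_le (S := L.ker) ?_
    (LinearMap.ker_coFG_iff_hasFiniteRange.2 LinearMap.HasFiniteRange.of_isNoetherian_rng)
  intro f hf
  rw [LinearMap.mem_ker]
  apply Lp.ext
  filter_upwards [l2Op_coeFn (isL2Bounded_fnK hl hκ hC) f, Lp.coeFn_zero ℂ 2 volume] with k h1 h2
  have h3 : pairing (hm (rep ⟨i k, k, rfl⟩)) f = 0 := congrFun hf ⟨i k, k, rfl⟩
  have h4 : κ (rep ⟨i k, k, rfl⟩) = κ k := hκi _ _ (hrep _)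
  rw [pairing_apply, h4] at h3
  simp only [mul_assoc] at h3
  refine h1.trans ?_
  rw [h2, fnK, h3, mul_zero, Pi.zero_apply]

end kernel

/-! ### The Schur complement -/

section Schur

variable {d : ℕ} {ω : Rd d → ℝ} {lam : Rd d → ℂ} {γ α : ℝ}

/-- The multiplication part `Φ(z - ω(k))` of the Schur complement of `D - z` in `𝒜 - z`, for
complex `z`. -/
noncomputable def schurFn (ω : Rd d → ℝ) (lam : Rd d → ℂ) (γ α : ℝ) (z : ℂ) (k : Rd d) : ℂ :=
  -γ + ω k - z - α ^ 2 * ∫ q, (γ + ω k + ω q - z : ℂ)⁻¹ * (‖lam q‖ ^ 2 : ℝ)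

theorem norm_resolvent_le {z : ℂ} {c : ℝ} (hc0 : 0 < c)
    (hcz : ∀ k q, c ≤ ‖(γ + ω k + ω q - z : ℂ)‖) (k q : Rd d) :
    ‖(γ + ω k + ω q - z : ℂ)⁻¹‖ ≤ c⁻¹ := by
  rw [norm_inv]
  exact inv_anti₀ hc0 (hcz k q)

theorem measurable_resolvent (hc : Continuous ω) (z : ℂ) (k : Rd d) :
    Measurable fun q => (γ + ω k + ω q - z : ℂ)⁻¹ :=
  (by fun_prop : Measurable fun q => (γ + ω k + ω q - z : ℂ)).inv

theorem integrable_resolvent (hc : Continuous ω) (hl : MemLp lam 2 volume) {z : ℂ} {c : ℝ}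
    (hc0 : 0 < c) (hcz : ∀ k q, c ≤ ‖(γ + ω k + ω q - z : ℂ)‖) (k : Rd d) :
    Integrable (fun q => (γ + ω k + ω q - z : ℂ)⁻¹ * (‖lam q‖ ^ 2 : ℝ)) volume :=
  (integrable_norm_sq hl).ofReal.bdd_mul (measurable_resolvent hc z k).aestronglyMeasurable
    (Filter.Eventually.of_forall fun q => norm_resolvent_le hc0 hcz k q)

theorem aestronglyMeasurable_schurFn (hc : Continuous ω) (hl : MemLp lam 2 volume) (z : ℂ) :
    AEStronglyMeasurable (schurFn ω lam γ α z) volume := by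
  have h1 : Measurable fun p : Rd d × Rd d => (γ + ω p.1 + ω p.2 - z : ℂ)⁻¹ :=
    (by fun_prop : Measurable fun p : Rd d × Rd d => (γ + ω p.1 + ω p.2 - z : ℂ)).inv
  have h2 : AEStronglyMeasurable (fun p : Rd d × Rd d => ((‖lam p.2‖ ^ 2 : ℝ) : ℂ))
      ((volume : Measure (Rd d)).prod (volume : Measure (Rd d))) :=
    Complex.continuous_ofReal.comp_aestronglyMeasurable (hl.1.comp_snd.norm.pow 2)
  have h3 : AEStronglyMeasurable
      (fun k => ∫ q, (γ + ω k + ω q - z : ℂ)⁻¹ * (‖lam q‖ ^ 2 : ℝ)) volume :=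
    (h1.aestronglyMeasurable.mul h2).integral_prod_right'
  exact (by fun_prop : Continuous fun k => (-γ + ω k - z : ℂ)).aestronglyMeasurable.sub
    (h3.const_mul _)

theorem exists_norm_schurFn_le (h0 : ∀ k, 0 ≤ ω k) (hb : BddAbove (range ω))
    (hl : MemLp lam 2 volume) {z : ℂ} {c : ℝ} (hc0 : 0 < c)
    (hcz : ∀ k q, c ≤ ‖(γ + ω k + ω q - z : ℂ)‖) :
    ∃ C : ℝ, ∀ k, ‖schurFn ω lam γ α z k‖ ≤ C := by
  obtain ⟨M, hM⟩ := exists_abs_le h0 hb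
  refine ⟨|γ| + M + ‖z‖ + α ^ 2 * ∫ q, c⁻¹ * ‖lam q‖ ^ 2, fun k => ?_⟩
  have h1 : ‖∫ q, (γ + ω k + ω q - z : ℂ)⁻¹ * (‖lam q‖ ^ 2 : ℝ)‖ ≤ ∫ q, c⁻¹ * ‖lam q‖ ^ 2 := by
    refine norm_integral_le_of_norm_le ((integrable_norm_sq hl).const_mul _)
      (Filter.Eventually.of_forall fun q => ?_)
    rw [norm_mul, Complex.norm_real, Real.norm_of_nonneg (by positivity)]
    gcongr
    exact norm_resolvent_le hc0 hcz k q
  have h2 : ‖(-γ + ω k : ℂ)‖ ≤ |γ| + M := by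
    refine (norm_add_le _ _).trans ?_
    rw [norm_neg, Complex.norm_real, Complex.norm_real]
    exact add_le_add le_rfl (hM k)
  have h3 : ‖(α ^ 2 : ℂ)‖ = α ^ 2 := by
    rw [norm_pow, Complex.norm_real, Real.norm_eq_abs, sq_abs]
  unfold schurFn
  refine (norm_sub_le _ _).trans (add_le_add ((norm_sub_le _ _).trans (add_le_add h2 le_rfl)) ?_)
  rw [norm_mul, h3]
  gcongr

/-- The formula for `B (D - z)⁻¹ C`: a multiplication operator plus an integral operator. -/
theorem fnB_resolvent_fnC (hc : Continuous ω) (hl : MemLp lam 2 volume) {z : ℂ} {c : ℝ}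
    (hc0 : 0 < c) (hcz : ∀ k q, c ≤ ‖(γ + ω k + ω q - z : ℂ)‖) {f : Rd d → ℂ}
    (hf : MemLp f 2 volume) (k : Rd d) :
    fnB lam α (fun p => (γ + ω p.1 + ω p.2 - z : ℂ)⁻¹ * fnC lam α f p) k =
      (α ^ 2 * ∫ q, (γ + ω k + ω q - z : ℂ)⁻¹ * (‖lam q‖ ^ 2 : ℝ)) * f k +
        α ^ 2 * (conj (lam k) * ∫ q, (γ + ω k + ω q - z : ℂ)⁻¹ * (lam q * f q)) := by
  have h1 : ∀ q, (γ + ω k + ω q - z : ℂ)⁻¹ * fnC lam α f (k, q) * lam q =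
      α * f k * ((γ + ω k + ω q - z : ℂ)⁻¹ * (‖lam q‖ ^ 2 : ℝ)) +
        α * conj (lam k) * ((γ + ω k + ω q - z : ℂ)⁻¹ * (lam q * f q)) := fun q => by
    have h2 : (((‖lam q‖ ^ 2 : ℝ)) : ℂ) = conj (lam q) * lam q := by
      rw [Complex.conj_mul']
      push_cast
      rfl
    rw [h2]
    simp only [fnC]
    ring
  simp only [fnB, h1]
  rw [integral_add ((integrable_resolvent hc hl hc0 hcz k).const_mul _)
    ((integrable_kernel hl (measurable_resolvent hc z k) (norm_resolvent_le hc0 hcz k)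
      hf).const_mul _), integral_const_mul, integral_const_mul]
  ring

/-- The kernel `-α² / (γ + ω(k) + ω(q) - z)`, with `ω(k)` replaced by a function `s(k)`. -/
noncomputable def schurKernel (ω s : Rd d → ℝ) (γ α : ℝ) (z : ℂ) (k q : Rd d) : ℂ :=
  -α ^ 2 * (γ + s k + ω q - z : ℂ)⁻¹

theorem measurable_schurKernel (hc : Continuous ω) {s : Rd d → ℝ} (hs : Measurable s) (z : ℂ) :
    Measurable (Function.uncurry (schurKernel ω s γ α z)) := by
  have h : Measurable fun p : Rd d × Rd d => (γ + s p.1 + ω p.2 - z : ℂ) := by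
    have := hs.comp (measurable_fst : Measurable (Prod.fst : Rd d × Rd d → Rd d))
    fun_prop
  exact h.inv.const_mul _

theorem norm_schurKernel_le {z : ℂ} {c : ℝ} (hc0 : 0 < c) {s : Rd d → ℝ}
    (hcz : ∀ k q, c ≤ ‖(γ + s k + ω q - z : ℂ)‖) (k q : Rd d) :
    ‖schurKernel ω s γ α z k q‖ ≤ (α ^ 2 / c).toNNReal := by
  rw [Real.coe_toNNReal _ (by positivity), schurKernel, norm_mul, norm_neg, norm_pow,
    Complex.norm_real, Real.norm_eq_abs, sq_abs, norm_inv, div_eq_mul_inv]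
  gcongr
  exact hcz k q

theorem norm_schurKernel_sub_le {z : ℂ} {c δ : ℝ} (hc0 : 0 < c) {s t : Rd d → ℝ}
    (hs : ∀ k q, c ≤ ‖(γ + s k + ω q - z : ℂ)‖) (ht : ∀ k q, c / 2 ≤ ‖(γ + t k + ω q - z : ℂ)‖)
    (hst : ∀ k, |t k - s k| ≤ δ) (k q : Rd d) :
    ‖schurKernel ω s γ α z k q - schurKernel ω t γ α z k q‖ ≤ α ^ 2 * δ / (c * (c / 2)) := by
  have hδ : 0 ≤ δ := (abs_nonneg _).trans (hst k)
  have h1 : (γ + s k + ω q - z : ℂ) ≠ 0 := norm_pos_iff.1 (hc0.trans_le (hs k q))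
  have h2 : (γ + t k + ω q - z : ℂ) ≠ 0 := norm_pos_iff.1 ((half_pos hc0).trans_le (ht k q))
  have h3 : schurKernel ω s γ α z k q - schurKernel ω t γ α z k q =
      -α ^ 2 * ((t k - s k : ℝ) / ((γ + s k + ω q - z) * (γ + t k + ω q - z))) := by
    simp only [schurKernel]
    push_cast
    field_simp
    ring
  rw [h3, norm_mul, norm_neg, norm_pow, Complex.norm_real, Real.norm_eq_abs, sq_abs, norm_div,
    norm_mul, Complex.norm_real, Real.norm_eq_abs, mul_div_assoc]
  gcongr
  · exact hst k
  · exact hs k q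
  · exact ht k q

/-- `𝒜 - z` is Fredholm if `D - z` is invertible and the multiplication part of the Schur complement
is bounded away from zero. The integral operator in the Schur complement is approximated in norm by
operators of finite rank, by rounding the argument `ω(k)` of its kernel to multiples of a small
`δ`. -/
theorem isFredholm_of_le_norm (h0 : ∀ k, 0 ≤ ω k) (hc : Continuous ω) (hb : BddAbove (range ω))
    (hl : MemLp lam 2 volume) {z : ℂ} (hD : ∃ c > 0, ∀ k q, c ≤ ‖(γ + ω k + ω q - z : ℂ)‖)
    (hS : ∃ c > 0, ∀ k, c ≤ ‖schurFn ω lam γ α z k‖) :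
    (opMatrix h0 hc hb hl γ α - z • ContinuousLinearMap.id ℂ (Hil d)).IsFredholm := by
  obtain ⟨c, hc0, hcz⟩ := hD
  have hden : ∀ k q, (γ + ω k + ω q - z : ℂ) ≠ 0 := fun k q =>
    norm_pos_iff.1 (hc0.trans_le (hcz k q))
  -- the inverse of `D - z`
  have hrm : AEStronglyMeasurable (fun p : Rd d × Rd d => (γ + ω p.1 + ω p.2 - z : ℂ)⁻¹)
      (halfVol d) :=
    (by fun_prop : Measurable fun p : Rd d × Rd d => (γ + ω p.1 + ω p.2 - z : ℂ)).inv
      |>.aestronglyMeasurable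
  have hrb : ∃ C : ℝ, ∀ p : Rd d × Rd d, ‖(γ + ω p.1 + ω p.2 - z : ℂ)⁻¹‖ ≤ C :=
    ⟨c⁻¹, fun p => norm_resolvent_le hc0 hcz p.1 p.2⟩
  have hrs : ∀ p : Rd d × Rd d, (γ + ω p.swap.1 + ω p.swap.2 - z : ℂ)⁻¹ =
      (γ + ω p.1 + ω p.2 - z : ℂ)⁻¹ := fun p => by
    rw [Prod.fst_swap, Prod.snd_swap]
    congr 1
    ring
  set R := mulL2s _ hrm hrb hrs
  have hRg : ∀ g : L2s d, (R g : Lp ℂ 2 (halfVol d)) =ᵐ[halfVol d] fun p =>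
    (γ + ω p.1 + ω p.2 - z : ℂ)⁻¹ * (g : Lp ℂ 2 (halfVol d)) p := mulL2s_coeFn hrm hrb hrs
  -- the multiplication part of the Schur complement
  have hsm := aestronglyMeasurable_schurFn (γ := γ) (α := α) hc hl z
  have hsb := exists_norm_schurFn_le (α := α) h0 hb hl hc0 hcz
  obtain ⟨m, hunit, hmf⟩ : ∃ m : L2 d →L[ℂ] L2 d, IsUnit m ∧ ∀ f : L2 d, m f =ᵐ[volume]
      fun k => schurFn ω lam γ α z k * f k :=
    ⟨_, isUnit_mul hsm hsb hS, l2Op_coeFn (isL2Bounded_mul _ hsm hsb)⟩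
  obtain ⟨ε, hε, hball⟩ := Metric.isOpen_iff.1 Units.isOpen m hunit
  -- the rounded kernel
  set N : ℝ := (((eLpNorm lam 2 volume).toNNReal ^ 2 : ℝ≥0) : ℝ)
  have hN0 : 0 ≤ N := NNReal.coe_nonneg _
  obtain ⟨δ, hδ0, hδc, hδε⟩ : ∃ δ > 0, δ ≤ c / 2 ∧ α ^ 2 * δ / (c * (c / 2)) * N < ε := by
    refine ⟨min (c / 2) (ε * (c * (c / 2)) / (α ^ 2 * N + 1)), by positivity, min_le_left _ _, ?_⟩
    calc α ^ 2 * min (c / 2) (ε * (c * (c / 2)) / (α ^ 2 * N + 1)) / (c * (c / 2)) * N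
        ≤ α ^ 2 * (ε * (c * (c / 2)) / (α ^ 2 * N + 1)) / (c * (c / 2)) * N := by
          gcongr
          exact min_le_right _ _
      _ = ε * (α ^ 2 * N / (α ^ 2 * N + 1)) := by field_simp
      _ < ε * 1 := by
          gcongr
          rw [div_lt_one (by positivity)]
          linarith
      _ = ε := mul_one ε
  let i : Rd d → ℤ := fun k => ⌊ω k / δ⌋
  let s : Rd d → ℝ := fun k => δ * i k
  have hs : Measurable s := by
    have : Measurable i := Int.measurable_floor.comp (hc.measurable.div_const δ)
    exact ((measurable_from_top (f := fun n : ℤ => (n : ℝ))).comp this).const_mul δ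
  have hsω : ∀ k, |s k - ω k| ≤ δ := fun k => by
    have h1 := Int.floor_le (ω k / δ)
    have h2 := Int.lt_floor_add_one (ω k / δ)
    have h3 : ω k = δ * (ω k / δ) := by field_simp
    rw [abs_le]
    constructor
    · have := mul_lt_mul_of_pos_left h2 hδ0
      simp only [s, i]
      linarith
    · have := mul_le_mul_of_nonneg_left h1 hδ0.le
      simp only [s, i]
      linarith
  have hcs : ∀ k q, c / 2 ≤ ‖(γ + s k + ω q - z : ℂ)‖ := fun k q => by
    have h1 : (γ + ω k + ω q - z : ℂ) = (γ + s k + ω q - z) - (s k - ω k : ℝ) := by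
      push_cast
      ring
    have h2 := hcz k q
    rw [h1] at h2
    have h3 := norm_sub_le (γ + s k + ω q - z : ℂ) (s k - ω k : ℝ)
    rw [Complex.norm_real, Real.norm_eq_abs] at h3
    linarith [hsω k]
  have hifin : (range i).Finite := by
    obtain ⟨M, hM⟩ := exists_abs_le h0 hb
    refine (Set.finite_Icc 0 ⌊M / δ⌋).subset ?_
    rintro _ ⟨k, rfl⟩
    refine ⟨Int.floor_nonneg.2 (div_nonneg (h0 k) hδ0.le), Int.floor_le_floor ?_⟩
    gcongr
    exact (le_abs_self _).trans (hM k)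
  have hκm := measurable_schurKernel (γ := γ) (α := α) hc hc.measurable z
  have hκm' := measurable_schurKernel (γ := γ) (α := α) hc hs z
  have hκb := norm_schurKernel_le (α := α) hc0 hcz
  have hκb' := norm_schurKernel_le (α := α) (half_pos hc0) hcs
  have hdm : Measurable (Function.uncurry fun k q =>
      schurKernel ω ω γ α z k q - schurKernel ω s γ α z k q) := hκm.sub hκm'
  have hdb : ∀ k q, ‖schurKernel ω ω γ α z k q - schurKernel ω s γ α z k q‖ ≤
      (α ^ 2 * δ / (c * (c / 2))).toNNReal := fun k q => by
    rw [Real.coe_toNNReal _ (by positivity)]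
    exact norm_schurKernel_sub_le hc0 hcz hcs hsω k q
  obtain ⟨K, hKn, hKf⟩ : ∃ K : L2 d →L[ℂ] L2 d, ‖K‖ < ε ∧ ∀ f : L2 d, K f =ᵐ[volume]
      fnK lam (fun k q => schurKernel ω ω γ α z k q - schurKernel ω s γ α z k q) f := by
    refine ⟨_, ?_, l2Op_coeFn (isL2Bounded_fnK hl hdm hdb)⟩
    refine (norm_l2Op_le _ _ fun f hf => eLpNorm_fnK_le hl hdb hf).trans_lt ?_
    rw [NNReal.coe_mul, Real.coe_toNNReal _ (by positivity)]
    exact hδε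
  obtain ⟨T, hTfr, hTf⟩ : ∃ T : L2 d →L[ℂ] L2 d, T.toLinearMap.HasFiniteRange ∧
      ∀ f : L2 d, T f =ᵐ[volume] fnK lam (schurKernel ω s γ α z) f := by
    refine ⟨_, hasFiniteRange_fnK hl hκm' hκb' i hifin fun k k' h => ?_,
      l2Op_coeFn (isL2Bounded_fnK hl hκm' hκb')⟩
    funext q
    simp only [schurKernel, s, h]
  have hU : IsUnit (m + K) := hball (by simpa [dist_eq_norm] using hKn)
  rw [opMatrix_eq_blockOp, blockOp_sub_smul_id]
  refine isFredholm_blockOp _ _ _ _ (R := R) (fun g => ?_) (fun g => ?_) hU ?_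
  · apply L2s_ext
    filter_upwards [hRg ((opD h0 hc hb γ - z • ContinuousLinearMap.id ℂ (L2s d)) g),
      opD_sub_coeFn h0 hc hb γ z g] with p h1 h2
    rw [h1, h2, inv_mul_cancel_left₀ (hden _ _)]
  · apply L2s_ext
    filter_upwards [hRg g, opD_sub_coeFn h0 hc hb γ z (R g)] with p h1 h2
    rw [h2, h1, mul_inv_cancel_left₀ (hden _ _)]
  · suffices h : opA h0 hc hb γ - z • ContinuousLinearMap.id ℂ (L2 d) -
        opB hl α ∘L R ∘L opC hl α - (m + K) = T by
      rw [h]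
      exact hTfr
    ext1 f
    apply Lp.ext
    have e1 : opB hl α (R (opC hl α f)) =ᵐ[volume]
        fnB lam α (fun p => (γ + ω p.1 + ω p.2 - z : ℂ)⁻¹ * fnC lam α f p) := by
      refine (opB_coeFn hl α _).trans ((isL2Bounded_fnB hl α).congr _ _ ?_)
      filter_upwards [hRg (opC hl α f), opC_coeFn hl α f] with p h1 h2
      rw [h1, h2]
    change ⇑((opA h0 hc hb γ - z • ContinuousLinearMap.id ℂ (L2 d)) f -
      opB hl α (R (opC hl α f)) - (m f + K f)) =ᵐ[volume] _
    filter_upwards [Lp.coeFn_sub ((opA h0 hc hb γ - z • ContinuousLinearMap.id ℂ (L2 d)) f -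
        opB hl α (R (opC hl α f))) (m f + K f),
      Lp.coeFn_sub ((opA h0 hc hb γ - z • ContinuousLinearMap.id ℂ (L2 d)) f)
        (opB hl α (R (opC hl α f))), Lp.coeFn_add (m f) (K f), e1, opA_sub_coeFn h0 hc hb γ z f,
      hmf f, hKf f, hTf f] with k h1 h2 h3 h4 h5 h6 h7 h8
    have hf := Lp.memLp f
    have h9 : fnK lam (fun k q => schurKernel ω ω γ α z k q - schurKernel ω s γ α z k q) f k =
        fnK lam (schurKernel ω ω γ α z) f k - fnK lam (schurKernel ω s γ α z) f k := by
      simp only [fnK, sub_mul]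
      rw [integral_sub (integrable_kernel hl (hκm.of_uncurry_left) (hκb k) hf)
        (integrable_kernel hl (hκm'.of_uncurry_left) (hκb' k) hf), mul_sub]
    have h10 : fnK lam (schurKernel ω ω γ α z) f k = -α ^ 2 *
        (conj (lam k) * ∫ q, (γ + ω k + ω q - z : ℂ)⁻¹ * (lam q * f q)) := by
      simp only [fnK, schurKernel, mul_assoc]
      rw [integral_const_mul]
      ring
    rw [h1, Pi.sub_apply, h2, Pi.sub_apply, h3, Pi.add_apply, h4, h5, h6, h7, h8, h9, h10,
      fnB_resolvent_fnC hc hl hc0 hcz hf, schurFn]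
    ring

/-- For real `z`, the multiplication part of the Schur complement is `Φ(z - ω(k))`. -/
theorem schurFn_ofReal (z : ℝ) (k : Rd d) :
    schurFn ω lam γ α z k = (Phi ω lam γ α (z - ω k) : ℂ) := by
  have h : ∀ q, (γ + ω k + ω q - z : ℂ)⁻¹ * (‖lam q‖ ^ 2 : ℝ) =
      ((‖lam q‖ ^ 2 / (ω q + γ - (z - ω k)) : ℝ) : ℂ) := fun q => by
    rw [Complex.ofReal_div, div_eq_mul_inv, mul_comm]
    congr 2
    push_cast
    ring
  simp only [schurFn, Phi, h]
  rw [integral_complex_ofReal]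
  push_cast
  ring

/-- For nonreal `z`, both terms in the imaginary part of `Φ(z - ω(k))` have the same sign. -/
theorem abs_im_le_norm_schurFn (hc : Continuous ω) (hl : MemLp lam 2 volume) {z : ℂ}
    (hz : z.im ≠ 0) (k : Rd d) : |z.im| ≤ ‖schurFn ω lam γ α z k‖ := by
  have hcz : ∀ k q, |z.im| ≤ ‖(γ + ω k + ω q - z : ℂ)‖ := fun k q => by
    refine le_trans ?_ (Complex.abs_im_le_norm _)
    simp
  have hint := integrable_resolvent hc hl (abs_pos.2 hz) hcz k
  have h1 : (∫ q, (γ + ω k + ω q - z : ℂ)⁻¹ * (‖lam q‖ ^ 2 : ℝ)).im =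
      z.im * ∫ q, ‖lam q‖ ^ 2 / Complex.normSq (γ + ω k + ω q - z : ℂ) := by
    rw [← integral_const_mul]
    have := integral_im hint
    simp only [RCLike.im_to_complex] at this
    rw [← this]
    refine integral_congr_ae (Filter.Eventually.of_forall fun q => ?_)
    simp only [Complex.im_mul_ofReal, Complex.inv_im]
    simp
    ring
  have h2 : 0 ≤ ∫ q, ‖lam q‖ ^ 2 / Complex.normSq (γ + ω k + ω q - z : ℂ) :=
    integral_nonneg fun q => div_nonneg (by positivity) (Complex.normSq_nonneg _)
  have h3 : (schurFn ω lam γ α z k).im =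
      -(z.im * (1 + α ^ 2 * ∫ q, ‖lam q‖ ^ 2 / Complex.normSq (γ + ω k + ω q - z : ℂ))) := by
    have : (α ^ 2 : ℂ) = ((α ^ 2 : ℝ) : ℂ) := by push_cast; rfl
    rw [schurFn, this, Complex.sub_im, Complex.im_ofReal_mul, h1]
    simp
    ring
  refine le_trans ?_ (Complex.abs_im_le_norm _)
  rw [h3, abs_neg, abs_mul]
  refine le_mul_of_one_le_right (abs_nonneg _) ?_
  refine le_trans ?_ (le_abs_self _)
  have := mul_nonneg (sq_nonneg α) h2
  linarith

end Schur

/-! ### Functions concentrated on an open set -/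

section supported

variable {d : ℕ} {ω : Rd d → ℝ} {lam : Rd d → ℂ} {γ α : ℝ}

/-- The subspace of all `f ∈ L²(ℝ^d)` that vanish almost everywhere outside `U`. -/
def supportedOn (U : Set (Rd d)) : Submodule ℂ (L2 d) where
  carrier := {f | ∀ᵐ k ∂(volume : Measure (Rd d)), k ∉ U → f k = 0}
  zero_mem' := by
    change ∀ᵐ k ∂(volume : Measure (Rd d)), _
    exact Filter.Eventually.of_forall fun k _ => by simp
  add_mem' := by
    intro f g hf hg
    change ∀ᵐ k ∂(volume : Measure (Rd d)), _
    filter_upwards [hf, hg, Lp.coeFn_add f g] with k h1 h2 h3 hk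
    rw [h3, Pi.add_apply, h1 hk, h2 hk, add_zero]
  smul_mem' := by
    intro c f hf
    change ∀ᵐ k ∂(volume : Measure (Rd d)), _
    filter_upwards [hf, Lp.coeFn_smul c f] with k h1 h3 hk
    rw [h3, Pi.smul_apply, h1 hk, smul_zero]

theorem mem_supportedOn {U : Set (Rd d)} {f : L2 d} :
    f ∈ supportedOn U ↔ ∀ᵐ k ∂(volume : Measure (Rd d)), k ∉ U → f k = 0 := Iff.rfl

/-- A nonempty open set contains infinitely many disjoint nonempty open sets, whose indicator
functions are linearly independent. -/
theorem not_fg_supportedOn (hd : Nontrivial (Rd d)) {U : Set (Rd d)} (hU : IsOpen U)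
    (hne : U.Nonempty) : ¬ (supportedOn U).FG := by
  intro hfg
  obtain ⟨x, hx⟩ := hne
  have hopen : IsOpen (U ∩ Metric.ball x 1) := hU.inter Metric.isOpen_ball
  have hinf : Infinite ↥(U ∩ Metric.ball x 1) :=
    (infinite_of_mem_nhds x (hopen.mem_nhds ⟨hx, Metric.mem_ball_self one_pos⟩)).to_subtype
  obtain ⟨V, hVi, hVo, hVd⟩ := exists_seq_infinite_isOpen_pairwise_disjoint ↥(U ∩ Metric.ball x 1)
  let S : ℕ → Set (Rd d) := fun n => Subtype.val '' V n
  have hSo : ∀ n, IsOpen (S n) := fun n => hopen.isOpenMap_subtype_val _ (hVo n)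
  have hSU : ∀ n, S n ⊆ U ∩ Metric.ball x 1 := fun n => by
    rintro _ ⟨y, _, rfl⟩
    exact y.2
  have hSd : ∀ m n, m ≠ n → Disjoint (S m) (S n) := fun m n hmn =>
    disjoint_image_of_injective Subtype.val_injective (hVd hmn)
  have hSfin : ∀ n, volume (S n) ≠ ∞ := fun n =>
    ((measure_mono ((hSU n).trans inter_subset_right)).trans_lt
      (measure_ball_lt_top (x := x) (r := 1))).ne
  have hSpos : ∀ n, volume (S n) ≠ 0 := fun n =>
    ((hSo n).measure_pos volume ((hVi n).nonempty.image _)).ne'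
  let e : ℕ → L2 d := fun n => indicatorConstLp 2 (hSo n).measurableSet (hSfin n) (1 : ℂ)
  have hli : LinearIndependent ℂ e := by
    refine linearIndependent_of_ne_zero_of_inner_eq_zero (𝕜 := ℂ) (fun n h => ?_) fun m n hmn => ?_
    · have h1 := congrArg norm h
      rw [norm_indicatorConstLp (by norm_num) (by norm_num), norm_zero] at h1
      have : 0 < volume.real (S n) := ENNReal.toReal_pos (hSpos n) (hSfin n)
      have : 0 < volume.real (S n) ^ (1 / (2 : ℝ≥0∞).toReal) := by positivity
      simp_all
    · simp only [e]
      rw [L2.inner_indicatorConstLp_one]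
      refine setIntegral_eq_zero_of_ae_eq_zero ?_
      filter_upwards [indicatorConstLp_coeFn (p := 2) (hs := (hSo n).measurableSet)
        (hμs := hSfin n) (c := (1 : ℂ))] with k hk hkm
      rw [hk]
      exact indicator_of_notMem (fun hkn => disjoint_left.1 (hSd m n hmn) hkm hkn) _
  have hmem : ∀ n, e n ∈ supportedOn U := fun n => by
    rw [mem_supportedOn]
    filter_upwards [indicatorConstLp_coeFn (p := 2) (hs := (hSo n).measurableSet)
      (hμs := hSfin n) (c := (1 : ℂ))] with k hk hkU
    simp only [e]
    rw [hk]
    exact indicator_of_notMem (fun hkn => hkU (hSU n hkn).1) _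
  have hli' : LinearIndependent ℂ fun n => (⟨e n, hmem n⟩ : supportedOn U) :=
    LinearIndependent.of_comp (supportedOn U).subtype hli
  have : Module.Finite ℂ (supportedOn U) := Module.Finite.of_fg hfg
  exact not_finite_iff_infinite.2 (inferInstance : Infinite ℕ) hli'.finite_of_isNoetherian

theorem not_fg_inf_ker {V : Type*} [AddCommGroup V] [Module ℂ V] {W : Submodule ℂ V}
    (hW : ¬ W.FG) (φ : V →ₗ[ℂ] ℂ) : ¬ (W ⊓ φ.ker).FG := fun h =>
  hW (Submodule.fg_of_fg_map_of_fg_inf_ker φ (IsNoetherian.noetherian _) h)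

theorem not_finiteDimensional_map {V V' : Type*} [AddCommGroup V] [Module ℂ V] [AddCommGroup V']
    [Module ℂ V'] {W : Submodule ℂ V} (hW : ¬ W.FG) (J : V →ₗ[ℂ] V')
    (hJ : ∀ x ∈ W, J x = 0 → x = 0) : ¬ FiniteDimensional ℂ (W.map J) := fun h => by
  refine hW (Submodule.fg_of_fg_map_of_fg_inf_ker J (Module.Finite.iff_fg.1 h) ?_)
  rw [show W ⊓ J.ker = ⊥ from (Submodule.eq_bot_iff _).2 fun x hx => hJ x hx.1 hx.2]
  exact Submodule.fg_bot

/-- The values of `ω` are dense in `[ω₀, ω₁]`. -/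
theorem exists_abs_sub_lt (hc : Continuous ω) {x : ℝ} (hx0 : omega0 ω ≤ x) (hx1 : x ≤ omega1 ω)
    {ε : ℝ} (hε : 0 < ε) : ∃ k, |ω k - x| < ε := by
  by_cases h1 : ∃ k, ω k ≤ x
  · by_cases h2 : ∃ k, x ≤ ω k
    · obtain ⟨k, hk⟩ := mem_range_of_exists_le_of_exists_ge hc h1 h2
      exact ⟨k, by simpa [hk] using hε⟩
    · push Not at h2
      obtain ⟨k, hk⟩ := exists_lt_of_lt_ciSup (show x - ε < ⨆ k, ω k by
        have : x - ε < omega1 ω := by linarith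
        exact this)
      have := h2 k
      exact ⟨k, by rw [abs_lt]; constructor <;> linarith⟩
  · push Not at h1
    obtain ⟨k, hk⟩ := exists_lt_of_ciInf_lt (show ⨅ k, ω k < x + ε by
      have : omega0 ω < x + ε := by linarith
      exact this)
    have := h1 k
    exact ⟨k, by rw [abs_lt]; constructor <;> linarith⟩

/-- States whose `ω` is within `ε` of `x` form an infinite-dimensional space. -/
theorem not_fg_supportedOn_near (hd : Nontrivial (Rd d)) (hc : Continuous ω) {x : ℝ}
    (hx0 : omega0 ω ≤ x) (hx1 : x ≤ omega1 ω) {ε : ℝ} (hε : 0 < ε) :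
    ¬ (supportedOn {k | |ω k - x| < ε}).FG :=
  not_fg_supportedOn hd (isOpen_lt (by fun_prop) continuous_const) (exists_abs_sub_lt hc hx0 hx1 hε)

theorem memLp_conj {g : Rd d → ℂ} (hg : MemLp g 2 volume) :
    MemLp (fun k => conj (g k)) 2 volume := hg.star

/-- The operator `u ↦ h ⊗ u + u ⊗ h` from `L²(ℝ^d)` to `L²_s(ℝ^d × ℝ^d)`. -/
noncomputable def symTensor {h : Rd d → ℂ} (hh : MemLp h 2 volume) : L2 d →L[ℂ] L2s d :=
  opC (memLp_conj hh) 1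

theorem symTensor_coeFn {h : Rd d → ℂ} (hh : MemLp h 2 volume) (u : L2 d) :
    (symTensor hh u : Lp ℂ 2 (halfVol d)) =ᵐ[halfVol d]
      fun p => h p.1 * u p.2 + h p.2 * u p.1 := by
  filter_upwards [opC_coeFn (memLp_conj hh) 1 u] with p hp
  rw [symTensor, hp]
  simp [fnC]

theorem opB_symTensor {g h : Rd d → ℂ} (hg : MemLp g 2 volume) (hh : MemLp h 2 volume) (α : ℝ)
    (u : L2 d) : opB hg α (symTensor hh u) =ᵐ[volume]
      fun k => α * (h k * pairing hg u + u k * ∫ q, g q * h q) := by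
  refine (opB_coeFn hg α _).trans
    (((isL2Bounded_fnB hg α).congr _ _ (symTensor_coeFn hh u)).trans ?_)
  filter_upwards with k
  have h1 : ∀ q, (h k * u q + h q * u k) * g q = h k * (g q * u q) + u k * (g q * h q) :=
    fun q => by ring
  have i1 : Integrable (fun q => g q * u q) volume := hg.integrable_mul (Lp.memLp u)
  have i2 : Integrable (fun q => g q * h q) volume := hg.integrable_mul hh
  simp only [fnB, h1]
  rw [integral_add (i1.const_mul _) (i2.const_mul _), integral_const_mul, integral_const_mul,
    pairing_apply]

theorem ae_comp_fst {p : Rd d → Prop} (h : ∀ᵐ k ∂(volume : Measure (Rd d)), p k) :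
    ∀ᵐ x ∂(halfVol d), p x.1 :=
  ae_halfVol.2 ((Measure.quasiMeasurePreserving_fst (μ := (volume : Measure (Rd d)))
    (ν := (volume : Measure (Rd d)))).ae h)

theorem ae_comp_snd {p : Rd d → Prop} (h : ∀ᵐ k ∂(volume : Measure (Rd d)), p k) :
    ∀ᵐ x ∂(halfVol d), p x.2 :=
  ae_halfVol.2 ((Measure.quasiMeasurePreserving_snd (μ := (volume : Measure (Rd d)))
    (ν := (volume : Measure (Rd d)))).ae h)

end supported

/-! ### Singular sequences -/

section singular

variable {d : ℕ} {ω : Rd d → ℝ} {lam : Rd d → ℂ} {γ α : ℝ}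

/-- Two particles with `ω` near `(z - γ)/2`, both orthogonal to `conj λ`, form approximate
eigenvectors of `𝒜` for `z`. -/
theorem not_isFredholm_of_mem_Icc (hd : Nontrivial (Rd d)) (h0 : ∀ k, 0 ≤ ω k) (hc : Continuous ω)
    (hb : BddAbove (range ω)) (hl : MemLp lam 2 volume) {z : ℝ}
    (hz : z ∈ Icc (2 * omega0 ω + γ) (2 * omega1 ω + γ)) :
    ¬ (opMatrix h0 hc hb hl γ α - (z : ℂ) • ContinuousLinearMap.id ℂ (Hil d)).IsFredholm := by
  refine not_isFredholm_of_small fun ε hε => ?_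
  set U := {k : Rd d | |ω k - (z - γ) / 2| < ε / 2}
  have hV : ¬ (supportedOn U ⊓ (pairing hl).toLinearMap.ker).FG :=
    not_fg_inf_ker (not_fg_supportedOn_near hd hc (by linarith [hz.1]) (by linarith [hz.2])
      (half_pos hε)) _
  set V := supportedOn U ⊓ (pairing hl).toLinearMap.ker
  obtain ⟨v, hvV, hv0⟩ := V.exists_mem_ne_zero_of_ne_bot fun h => hV (h ▸ Submodule.fg_bot)
  have hvm := Lp.memLp v
  have hlv : ∫ q, lam q * v q = 0 := (pairing_apply hl v).symm.trans hvV.2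
  have hW := not_fg_inf_ker hV (pairing (memLp_conj hvm)).toLinearMap
  have hvv : ∫ q, conj (v q) * v q ≠ 0 := by
    have : inner ℂ v v = ∫ q, conj (v q) * v q := by
      rw [L2.inner_def]
      refine integral_congr_ae (Filter.Eventually.of_forall fun q => ?_)
      simp only [RCLike.inner_apply]
      exact mul_comm _ _
    rw [← this]
    exact inner_self_ne_zero.2 hv0
  let J : L2 d →ₗ[ℂ] Hil d := ((WithLp.prodContinuousLinearEquiv 2 ℂ (L2 d) (L2s d)).symm
    : L2 d × L2s d →L[ℂ] Hil d).toLinearMap ∘ₗ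
      LinearMap.inr ℂ (L2 d) (L2s d) ∘ₗ (symTensor hvm).toLinearMap
  refine ⟨_, not_finiteDimensional_map hW J fun u hu hJu => ?_, ?_⟩
  · -- integrating against `conj v` recovers `u`
    have hT : symTensor hvm u = 0 := congrArg (fun x : Hil d => x.snd) hJu
    have hpu : pairing (memLp_conj hvm) u = 0 := hu.2
    have h1 := opB_symTensor (memLp_conj hvm) hvm 1 u
    rw [hT, map_zero, hpu] at h1
    apply Lp.ext
    filter_upwards [h1, Lp.coeFn_zero ℂ 2 (volume : Measure (Rd d))] with k h2 h3
    rw [h3] at h2 ⊢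
    have h4 : (0 : ℂ) = u k * ∫ q, conj (v q) * v q := by simpa using h2
    exact (mul_eq_zero.1 h4.symm).resolve_right hvv
  · rintro _ ⟨u, hu, rfl⟩
    have hpu : pairing hl u = 0 := hu.1.2
    have hBT : opB hl α (symTensor hvm u) = 0 := by
      apply Lp.ext
      filter_upwards [opB_symTensor hl hvm α u, Lp.coeFn_zero ℂ 2 (volume : Measure (Rd d))]
        with k h1 h2
      rw [h1, h2, hpu, hlv]
      simp
    have hJ : J u = WithLp.toLp 2 (0, symTensor hvm u) := rfl
    rw [opMatrix_eq_blockOp, blockOp_sub_smul_id, hJ]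
    refine norm_blockOp_inr_le _ _ _ _ hBT ?_
    rw [← Submodule.norm_coe, ← Submodule.norm_coe]
    apply Lp.norm_le_mul_norm_of_ae_le_mul
    filter_upwards [opD_sub_coeFn h0 hc hb γ z (symTensor hvm u), symTensor_coeFn hvm u,
      ae_comp_fst (mem_supportedOn.1 hvV.1), ae_comp_fst (mem_supportedOn.1 hu.1.1),
      ae_comp_snd (mem_supportedOn.1 hvV.1), ae_comp_snd (mem_supportedOn.1 hu.1.1)]
      with p h1 h2 h3 h4 h5 h6
    rw [h1, norm_mul]
    by_cases hp1 : p.1 ∈ U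
    · by_cases hp2 : p.2 ∈ U
      · gcongr
        have h7 : (γ + ω p.1 + ω p.2 - z : ℂ) =
            ((ω p.1 - (z - γ) / 2 + (ω p.2 - (z - γ) / 2) : ℝ) : ℂ) := by
          push_cast
          ring
        rw [h7, Complex.norm_real, Real.norm_eq_abs]
        have := abs_add_le (ω p.1 - (z - γ) / 2) (ω p.2 - (z - γ) / 2)
        have h8 : |ω p.1 - (z - γ) / 2| < ε / 2 := hp1
        have h9 : |ω p.2 - (z - γ) / 2| < ε / 2 := hp2
        linarith
      · rw [h2, h5 hp2, h6 hp2]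
        simp
    · rw [h2, h3 hp1, h4 hp1]
      simp

theorem exists_le_abs_of_outside (hb' : BddBelow (range ω)) (hb : BddAbove (range ω)) {e : ℝ}
    (he : e < omega0 ω + γ ∨ omega1 ω + γ < e) : ∃ c > 0, ∀ q, c ≤ |ω q + γ - e| := by
  rcases he with he | he
  · exact ⟨omega0 ω + γ - e, by linarith, fun q => by
      have := omega0_le hb' q
      rw [le_abs]
      left
      linarith⟩
  · exact ⟨e - omega1 ω - γ, by linarith, fun q => by
      have := le_omega1 hb q
      rw [le_abs]
      right
      linarith⟩

/-- If `e` is a zero of `Φ`, then `(1, h)` with `h = -α conj λ / (ω + γ - e)` is an eigenvector for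
`e` of the one-particle problem. Consequently `u ↦ (u, h ⊗ u + u ⊗ h)` intertwines `𝒜 - z` with
multiplication by `ω + e - z`, for `u` orthogonal to `conj λ`. -/
theorem opMatrix_sub_apply_of_zero (h0 : ∀ k, 0 ≤ ω k) (hc : Continuous ω)
    (hb : BddAbove (range ω)) (hl : MemLp lam 2 volume) {e z : ℝ} {h : Rd d → ℂ}
    (hh : MemLp h 2 volume) (hlh : (α : ℂ) * ∫ q, lam q * h q = γ + e)
    (hhl : ∀ q, (ω q + γ - e) * h q = -α * conj (lam q)) {u w : L2 d}
    (hw : w =ᵐ[volume] fun k => (ω k + e - z : ℂ) * u k) (hu : pairing hl u = 0) :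
    (opMatrix h0 hc hb hl γ α - (z : ℂ) • ContinuousLinearMap.id ℂ (Hil d))
      (WithLp.toLp 2 (u, symTensor hh u)) = WithLp.toLp 2 (w, symTensor hh w) := by
  rw [opMatrix_eq_blockOp, blockOp_sub_smul_id, blockOp_toLp]
  congr 2
  · apply Lp.ext
    filter_upwards [Lp.coeFn_add ((opA h0 hc hb γ - (z : ℂ) • ContinuousLinearMap.id ℂ (L2 d)) u)
      (opB hl α (symTensor hh u)), opA_sub_coeFn h0 hc hb γ z u, opB_symTensor hl hh α u, hw]
      with k h1 h2 h3 h4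
    rw [h1, Pi.add_apply, h2, h3, h4, hu]
    linear_combination u k * hlh
  · apply L2s_ext
    filter_upwards [coeFn_L2s_add (opC hl α u)
      ((opD h0 hc hb γ - (z : ℂ) • ContinuousLinearMap.id ℂ (L2s d)) (symTensor hh u)),
      opC_coeFn hl α u, opD_sub_coeFn h0 hc hb γ z (symTensor hh u), symTensor_coeFn hh u,
      symTensor_coeFn hh w, ae_comp_fst hw, ae_comp_snd hw]
      with p h1 h2 h3 h4 h5 h6 h7
    rw [h1, h2, h3, h4, h5, h6, h7, fnC]
    linear_combination u p.2 * hhl p.1 + u p.1 * hhl p.2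

/-- If `e` is a zero of `Φ` and `x ∈ [ω₀, ω₁]`, then the states `(u, h ⊗ u + u ⊗ h)` with `u`
orthogonal to `conj λ` and concentrated where `ω` is near `x` are approximate eigenvectors of `𝒜`
for `x + e`. -/
theorem not_isFredholm_of_zero (hd : Nontrivial (Rd d)) (h0 : ∀ k, 0 ≤ ω k) (hc : Continuous ω)
    (hb : BddAbove (range ω)) (hl : MemLp lam 2 volume) {e : ℝ}
    (he : e < omega0 ω + γ ∨ omega1 ω + γ < e) (hΦ : Phi ω lam γ α e = 0) {z : ℝ}
    (hz : z ∈ Icc (omega0 ω + e) (omega1 ω + e)) :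
    ¬ (opMatrix h0 hc hb hl γ α - (z : ℂ) • ContinuousLinearMap.id ℂ (Hil d)).IsFredholm := by
  have hb' : BddBelow (range ω) := ⟨0, by rintro _ ⟨k, rfl⟩; exact h0 k⟩
  obtain ⟨c, hc0, hce⟩ := exists_le_abs_of_outside hb' hb he
  have hden : ∀ q, (ω q + γ - e : ℂ) ≠ 0 := fun q => by
    have : ω q + γ - e ≠ 0 := abs_pos.1 (hc0.trans_le (hce q))
    exact_mod_cast this
  let h : Rd d → ℂ := fun q => -α * conj (lam q) / (ω q + γ - e)
  have hh : MemLp h 2 volume := by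
    refine MemLp.of_le_mul (c := |α| / c) hl ?_ (Filter.Eventually.of_forall fun q => ?_)
    · exact (((memLp_conj hl).1.aemeasurable.const_mul _).div
        (by fun_prop : Measurable fun q => (ω q + γ - e : ℂ)).aemeasurable).aestronglyMeasurable
    · have h1 : (ω q + γ - e : ℂ) = ((ω q + γ - e : ℝ) : ℂ) := by push_cast; rfl
      simp only [h]
      rw [norm_div, norm_mul, norm_neg, Complex.norm_real, RCLike.norm_conj, h1, Complex.norm_real,
        Real.norm_eq_abs, Real.norm_eq_abs, div_mul_eq_mul_div]
      gcongr
      exact hce q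
  have hlh : (α : ℂ) * ∫ q, lam q * h q = γ + e := by
    have h1 : ∀ q, lam q * h q = ((-α * (‖lam q‖ ^ 2 / (ω q + γ - e)) : ℝ) : ℂ) := fun q => by
      have h2 : (((‖lam q‖ ^ 2 : ℝ)) : ℂ) = conj (lam q) * lam q := by
        rw [Complex.conj_mul']
        push_cast
        rfl
      rw [Complex.ofReal_mul, Complex.ofReal_div, h2]
      simp only [h]
      push_cast
      ring
    rw [integral_congr_ae (Filter.Eventually.of_forall h1), integral_complex_ofReal,
      integral_const_mul]
    unfold Phi at hΦ
    have h3 : α * (-α * ∫ q, ‖lam q‖ ^ 2 / (ω q + γ - e)) = γ + e := by linarith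
    exact_mod_cast h3
  let J : L2 d →L[ℂ] Hil d := ((WithLp.prodContinuousLinearEquiv 2 ℂ (L2 d) (L2s d)).symm
    : L2 d × L2s d →L[ℂ] Hil d) ∘L (ContinuousLinearMap.id ℂ (L2 d)).prod (symTensor hh)
  have hmm : AEStronglyMeasurable (fun k => (ω k + e - z : ℂ)) (volume : Measure (Rd d)) :=
    Continuous.aestronglyMeasurable (by fun_prop)
  have hmb : ∃ C : ℝ, ∀ k, ‖(ω k + e - z : ℂ)‖ ≤ C := by
    obtain ⟨M, hM⟩ := exists_abs_le h0 hb
    refine ⟨M + |e - z|, fun k => ?_⟩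
    have h1 : (ω k + e - z : ℂ) = ((ω k + (e - z) : ℝ) : ℂ) := by
      push_cast
      ring
    rw [h1, Complex.norm_real, Real.norm_eq_abs]
    exact (abs_add_le _ _).trans (add_le_add (hM k) le_rfl)
  obtain ⟨m, hm⟩ : ∃ m : L2 d →L[ℂ] L2 d, ∀ u : L2 d, m u =ᵐ[volume]
      fun k => (ω k + e - z : ℂ) * u k := ⟨_, l2Op_coeFn (isL2Bounded_mul _ hmm hmb)⟩
  have hJle : ∀ u, ‖u‖ ≤ ‖J u‖ := fun u => WithLp.norm_fst_le _ (J u)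
  refine not_isFredholm_of_small fun ε hε => ?_
  set δ := ε / (‖J‖ + 1) with hδ
  have hδ0 : 0 < δ := by positivity
  have hW := not_fg_inf_ker (not_fg_supportedOn_near hd hc (x := z - e) (by linarith [hz.1])
    (by linarith [hz.2]) hδ0) (pairing hl).toLinearMap
  refine ⟨_, not_finiteDimensional_map hW J.toLinearMap fun u _ hu => ?_, ?_⟩
  · have h1 := hJle u
    rw [show J u = 0 from hu, norm_zero] at h1
    exact norm_le_zero_iff.1 h1
  · rintro _ ⟨u, hu, rfl⟩
    have hmu : ‖m u‖ ≤ δ * ‖u‖ := by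
      apply Lp.norm_le_mul_norm_of_ae_le_mul
      filter_upwards [hm u, mem_supportedOn.1 hu.1] with k h1 h2
      rw [h1, norm_mul]
      by_cases hk : k ∈ {k | |ω k - (z - e)| < δ}
      · gcongr
        have h3 : (ω k + e - z : ℂ) = ((ω k - (z - e) : ℝ) : ℂ) := by
          push_cast
          ring
        rw [h3, Complex.norm_real, Real.norm_eq_abs]
        exact le_of_lt hk
      · rw [h2 hk]
        simp
    change ‖(opMatrix h0 hc hb hl γ α - (z : ℂ) • ContinuousLinearMap.id ℂ (Hil d)) (J u)‖ ≤
      ε * ‖J u‖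
    rw [show (opMatrix h0 hc hb hl γ α - (z : ℂ) • ContinuousLinearMap.id ℂ (Hil d)) (J u) =
      J (m u) from opMatrix_sub_apply_of_zero h0 hc hb hl hh hlh
        (fun q => mul_div_cancel₀ _ (hden q)) (hm u) hu.2]
    calc ‖J (m u)‖ ≤ ‖J‖ * (δ * ‖u‖) := (J.le_opNorm _).trans (by gcongr)
      _ ≤ (‖J‖ + 1) * (δ * ‖J u‖) := by
          gcongr
          · linarith
          · exact hJle u
      _ = ε * ‖J u‖ := by
          rw [hδ]
          field_simp

end singular

/-! ### The essential spectrum -/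

section essSpectrum

variable {d : ℕ} {ω : Rd d → ℝ} {lam : Rd d → ℂ} {γ α : ℝ}

/-- The translates of `[ω₀, ω₁]` by the zeros of `Φ` below `ω₀ + γ`. -/
def lowBranch (ω : Rd d → ℝ) (lam : Rd d → ℂ) (γ α : ℝ) : Set ℝ :=
  {x | ∃ e < omega0 ω + γ, Phi ω lam γ α e = 0 ∧ x ∈ Icc (omega0 ω + e) (omega1 ω + e)}

/-- The translates of `[ω₀, ω₁]` by the zeros of `Φ` above `ω₁ + γ`. -/
def highBranch (ω : Rd d → ℝ) (lam : Rd d → ℂ) (γ α : ℝ) : Set ℝ :=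
  {x | ∃ e, omega1 ω + γ < e ∧ Phi ω lam γ α e = 0 ∧ x ∈ Icc (omega0 ω + e) (omega1 ω + e)}

theorem lowBranch_eq {E : ℝ} (hE : IsLowerZero ω lam γ α E) :
    lowBranch ω lam γ α = Icc (omega0 ω + E) (omega1 ω + E) := by
  ext x
  constructor
  · rintro ⟨e, he, h0, hx⟩
    rwa [hE.2.2 e he h0] at hx
  · exact fun hx => ⟨E, hE.1, hE.2.1, hx⟩

theorem highBranch_eq {F : ℝ} (hF : IsUpperZero ω lam γ α F) :
    highBranch ω lam γ α = Icc (omega0 ω + F) (omega1 ω + F) := by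
  ext x
  constructor
  · rintro ⟨e, he, h0, hx⟩
    rwa [hF.2.2 e he h0] at hx
  · exact fun hx => ⟨F, hF.1, hF.2.1, hx⟩

theorem lowBranch_eq_empty (hb' : BddBelow (range ω)) (hc : Continuous ω) (hl : MemLp lam 2 volume)
    (hl0 : ¬ lam =ᵐ[volume] 0) (hα : 0 < α) (h : LowAbsent ω lam γ α) :
    lowBranch ω lam γ α = ∅ := by
  rw [lowAbsent_iff hb' hc hl hl0 hα] at h
  exact eq_empty_of_forall_notMem fun x ⟨e, he, h0, _⟩ => (h e he).ne' h0

theorem highBranch_eq_empty (hb : BddAbove (range ω)) (hc : Continuous ω) (hl : MemLp lam 2 volume)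
    (hl0 : ¬ lam =ᵐ[volume] 0) (hα : 0 < α) (h : HighAbsent ω lam γ α) :
    highBranch ω lam γ α = ∅ :=
  eq_empty_of_forall_notMem fun _ ⟨_, he, h0, _⟩ =>
    (Phi_neg_of_highAbsent hb hc hl hl0 hα h he).ne h0

/-- A real `x` outside the two-particle interval and both branches is not in the essential
spectrum. -/
theorem isFredholm_of_notMem (h0 : ∀ k, 0 ≤ ω k) (hc : Continuous ω) (hb : BddAbove (range ω))
    (hl : MemLp lam 2 volume) {x : ℝ}
    (hx : x ∉ lowBranch ω lam γ α ∪ Icc (2 * omega0 ω + γ) (2 * omega1 ω + γ) ∪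
      highBranch ω lam γ α) :
    (opMatrix h0 hc hb hl γ α - (x : ℂ) • ContinuousLinearMap.id ℂ (Hil d)).IsFredholm := by
  have hb' : BddBelow (range ω) := ⟨0, by rintro _ ⟨k, rfl⟩; exact h0 k⟩
  have hω0 := omega0_le hb'
  have hω1 := le_omega1 hb
  simp only [mem_union, not_or] at hx
  obtain ⟨⟨hxl, hxi⟩, hxh⟩ := hx
  have hnorm : ∀ k q, ‖(γ + ω k + ω q - x : ℂ)‖ = |γ + ω k + ω q - x| := fun k q => by
    rw [← Real.norm_eq_abs, ← Complex.norm_real]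
    push_cast
    rfl
  have hS : (∃ c > 0, ∀ w ∈ Icc (x - omega1 ω) (x - omega0 ω), c ≤ |Phi ω lam γ α w|) →
      ∃ c > 0, ∀ k, c ≤ ‖schurFn ω lam γ α x k‖ := by
    rintro ⟨c, hc0, hcw⟩
    refine ⟨c, hc0, fun k => ?_⟩
    rw [schurFn_ofReal, Complex.norm_real, Real.norm_eq_abs]
    exact hcw _ ⟨by linarith [hω1 k], by linarith [hω0 k]⟩
  rcases lt_or_ge x (2 * omega0 ω + γ) with h | h
  · refine isFredholm_of_le_norm h0 hc hb hl ⟨2 * omega0 ω + γ - x, by linarith, fun k q => ?_⟩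
      (hS (exists_le_abs_Phi hb' hc hl (by linarith) fun w hw hw0 => hxl
        ⟨w, by linarith [hw.2], hw0, by linarith [hw.2], by linarith [hw.1]⟩))
    rw [hnorm, le_abs]
    left
    linarith [hω0 k, hω0 q]
  · have h' : 2 * omega1 ω + γ < x := lt_of_not_ge fun h' => hxi ⟨h, h'⟩
    refine isFredholm_of_le_norm h0 hc hb hl ⟨x - (2 * omega1 ω + γ), by linarith, fun k q => ?_⟩
      (hS (exists_le_abs_Phi_upper hb hc hl (by linarith) fun w hw hw0 => hxh
        ⟨w, by linarith [hw.1], hw0, by linarith [hw.2], by linarith [hw.1]⟩))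
    rw [hnorm, le_abs]
    right
    linarith [hω1 k, hω1 q]

theorem isFredholm_of_im_ne_zero (h0 : ∀ k, 0 ≤ ω k) (hc : Continuous ω) (hb : BddAbove (range ω))
    (hl : MemLp lam 2 volume) {z : ℂ} (hz : z.im ≠ 0) :
    (opMatrix h0 hc hb hl γ α - z • ContinuousLinearMap.id ℂ (Hil d)).IsFredholm :=
  isFredholm_of_le_norm h0 hc hb hl
    ⟨|z.im|, abs_pos.2 hz, fun k q => le_trans (by simp) (Complex.abs_im_le_norm _)⟩
    ⟨|z.im|, abs_pos.2 hz, abs_im_le_norm_schurFn hc hl hz⟩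

/-- The essential spectrum consists of the two-particle interval and of the translates of
`[ω₀, ω₁]` by the zeros of `Φ`, for all values of the parameters. -/
theorem essSpectrumA_eq (hd : Nontrivial (Rd d)) (h0 : ∀ k, 0 ≤ ω k) (hc : Continuous ω)
    (hb : BddAbove (range ω)) (hl : MemLp lam 2 volume) :
    essSpectrumA h0 hc hb hl γ α = Complex.ofReal '' (lowBranch ω lam γ α ∪
      Icc (2 * omega0 ω + γ) (2 * omega1 ω + γ) ∪ highBranch ω lam γ α) := by
  apply Subset.antisymm
  · intro z hz
    by_cases him : z.im = 0
    · lift z to ℝ using him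
      refine ⟨z, ?_, rfl⟩
      by_contra hcon
      exact hz (isFredholm_of_notMem h0 hc hb hl hcon)
    · exact absurd (isFredholm_of_im_ne_zero h0 hc hb hl him) hz
  · rintro _ ⟨x, ((⟨e, he, hΦ, hx⟩ | hx) | ⟨e, he, hΦ, hx⟩), rfl⟩
    · exact not_isFredholm_of_zero hd h0 hc hb hl (Or.inl he) hΦ hx
    · exact not_isFredholm_of_mem_Icc hd h0 hc hb hl hx
    · exact not_isFredholm_of_zero hd h0 hc hb hl (Or.inr he) hΦ hx

theorem Icc_union_Icc_of_overlap {a b c e : ℝ} (h1 : a ≤ c) (h2 : c ≤ b) (h3 : b ≤ e) :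
    Icc a b ∪ Icc c e = Icc a e := by
  rw [Icc_union_Icc' h2 (h1.trans (h2.trans h3)), min_eq_left h1, max_eq_right h3]

end essSpectrum

theorem theorem2p1 {d : ℕ} (ω : Rd d → ℝ) (h0 : ∀ k, 0 ≤ ω k) (hc : Continuous ω)
    (hb : BddAbove (range ω)) (hnc : ∃ k q, ω k ≠ ω q)
    (lam : Rd d → ℂ) (hl : MemLp lam 2 volume) (hl0 : ¬ lam =ᵐ[volume] 0)
    (γ α : ℝ) (hα : 0 < α) :
    (LowAbsent ω lam γ α → HighAbsent ω lam γ α →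
      essSpectrumA h0 hc hb hl γ α =
        Complex.ofReal '' (Icc (2 * omega0 ω + γ) (2 * omega1 ω + γ))) ∧
    (LowAbsent ω lam γ α → HighAttached ω lam γ α →
      ∃ F : ℝ, IsUpperZero ω lam γ α F ∧
      essSpectrumA h0 hc hb hl γ α =
        Complex.ofReal '' (Icc (2 * omega0 ω + γ) (omega1 ω + F))) ∧
    (LowAbsent ω lam γ α → HighDetached ω lam γ α →
      ∃ F : ℝ, IsUpperZero ω lam γ α F ∧
      2 * omega1 ω + γ < omega0 ω + F ∧
      essSpectrumA h0 hc hb hl γ α =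
        Complex.ofReal '' (Icc (2 * omega0 ω + γ) (2 * omega1 ω + γ) ∪
          Icc (omega0 ω + F) (omega1 ω + F))) ∧
    (LowAttached ω lam γ α → HighAbsent ω lam γ α →
      ∃ E : ℝ, IsLowerZero ω lam γ α E ∧
      essSpectrumA h0 hc hb hl γ α =
        Complex.ofReal '' (Icc (omega0 ω + E) (2 * omega1 ω + γ))) ∧
    (LowAttached ω lam γ α → HighAttached ω lam γ α →
      ∃ E F : ℝ, IsLowerZero ω lam γ α E ∧ IsUpperZero ω lam γ α F ∧
      essSpectrumA h0 hc hb hl γ α =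
        Complex.ofReal '' (Icc (omega0 ω + E) (omega1 ω + F))) ∧
    (LowAttached ω lam γ α → HighDetached ω lam γ α →
      ∃ E F : ℝ, IsLowerZero ω lam γ α E ∧ IsUpperZero ω lam γ α F ∧
      2 * omega1 ω + γ < omega0 ω + F ∧
      essSpectrumA h0 hc hb hl γ α =
        Complex.ofReal '' (Icc (omega0 ω + E) (2 * omega1 ω + γ) ∪
          Icc (omega0 ω + F) (omega1 ω + F))) ∧
    (LowDetached ω lam γ α → HighAbsent ω lam γ α →
      ∃ E : ℝ, IsLowerZero ω lam γ α E ∧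
      omega1 ω + E < 2 * omega0 ω + γ ∧
      essSpectrumA h0 hc hb hl γ α =
        Complex.ofReal '' (Icc (omega0 ω + E) (omega1 ω + E) ∪
          Icc (2 * omega0 ω + γ) (2 * omega1 ω + γ))) ∧
    (LowDetached ω lam γ α → HighAttached ω lam γ α →
      ∃ E F : ℝ, IsLowerZero ω lam γ α E ∧ IsUpperZero ω lam γ α F ∧
      omega1 ω + E < 2 * omega0 ω + γ ∧
      essSpectrumA h0 hc hb hl γ α =
        Complex.ofReal '' (Icc (omega0 ω + E) (omega1 ω + E) ∪
          Icc (2 * omega0 ω + γ) (omega1 ω + F))) ∧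
    (LowDetached ω lam γ α → HighDetached ω lam γ α →
      ∃ E F : ℝ, IsLowerZero ω lam γ α E ∧ IsUpperZero ω lam γ α F ∧
      omega1 ω + E < 2 * omega0 ω + γ ∧ 2 * omega1 ω + γ < omega0 ω + F ∧
      essSpectrumA h0 hc hb hl γ α =
        Complex.ofReal '' (Icc (omega0 ω + E) (omega1 ω + E) ∪
          Icc (2 * omega0 ω + γ) (2 * omega1 ω + γ) ∪
          Icc (omega0 ω + F) (omega1 ω + F))) := by
  have hb' : BddBelow (range ω) := ⟨0, by rintro _ ⟨k, rfl⟩; exact h0 k⟩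
  have hlt := omega0_lt_omega1 hb' hb hnc
  have hd : Nontrivial (Rd d) := by
    obtain ⟨k, q, hkq⟩ := hnc
    exact ⟨k, q, fun h => hkq (by rw [h])⟩
  rw [essSpectrumA_eq hd h0 hc hb hl]
  have lab := lowBranch_eq_empty (γ := γ) hb' hc hl hl0 hα
  have hab := highBranch_eq_empty (γ := γ) hb hc hl hl0 hα
  have lat := exists_isLowerZero_of_attached (γ := γ) hb' hc hl hl0 hα hlt
  have hat := exists_isUpperZero_of_attached (γ := γ) hb' hb hc hl hl0 hα hlt
  have lde := exists_isLowerZero_of_detached (γ := γ) hb' hc hl hl0 hα hlt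
  have hde := exists_isUpperZero_of_detached (γ := γ) hb' hb hc hl hl0 hα hlt
  refine ⟨fun L H => ?_, fun L H => ?_, fun L H => ?_, fun L H => ?_, fun L H => ?_, fun L H => ?_,
    fun L H => ?_, fun L H => ?_, fun L H => ?_⟩
  · rw [lab L, hab H, empty_union, union_empty]
  · obtain ⟨F, hF, hle⟩ := hat H
    refine ⟨F, hF, ?_⟩
    rw [lab L, highBranch_eq hF, empty_union,
      Icc_union_Icc_of_overlap (by linarith [hF.1]) hle (by linarith [hF.1])]
  · obtain ⟨F, hF, hgap⟩ := hde H
    refine ⟨F, hF, hgap, ?_⟩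
    rw [lab L, highBranch_eq hF, empty_union]
  · obtain ⟨E, hE, hle⟩ := lat L
    refine ⟨E, hE, ?_⟩
    rw [lowBranch_eq hE, hab H, union_empty,
      Icc_union_Icc_of_overlap (by linarith [hE.1]) hle (by linarith [hE.1])]
  · obtain ⟨E, hE, hle⟩ := lat L
    obtain ⟨F, hF, hle'⟩ := hat H
    refine ⟨E, F, hE, hF, ?_⟩
    rw [lowBranch_eq hE, highBranch_eq hF,
      Icc_union_Icc_of_overlap (by linarith [hE.1]) hle (by linarith [hE.1]),
      Icc_union_Icc_of_overlap (by linarith [hE.1, hF.1]) hle' (by linarith [hF.1])]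
  · obtain ⟨E, hE, hle⟩ := lat L
    obtain ⟨F, hF, hgap⟩ := hde H
    refine ⟨E, F, hE, hF, hgap, ?_⟩
    rw [lowBranch_eq hE, highBranch_eq hF,
      Icc_union_Icc_of_overlap (by linarith [hE.1]) hle (by linarith [hE.1])]
  · obtain ⟨E, hE, hgap⟩ := lde L
    refine ⟨E, hE, hgap, ?_⟩
    rw [lowBranch_eq hE, hab H, union_empty]
  · obtain ⟨E, hE, hgap⟩ := lde L
    obtain ⟨F, hF, hle⟩ := hat H
    refine ⟨E, F, hE, hF, hgap, ?_⟩
    rw [lowBranch_eq hE, highBranch_eq hF, union_assoc,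
      Icc_union_Icc_of_overlap (by linarith [hF.1]) hle (by linarith [hF.1])]
  · obtain ⟨E, hE, hgap⟩ := lde L
    obtain ⟨F, hF, hgap'⟩ := hde H
    refine ⟨E, F, hE, hF, hgap, hgap', ?_⟩
    rw [lowBranch_eq hE, highBranch_eq hF]
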